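/- Let $\kappa_1<\dots<\kappa_n$ be real parameters that are generic, i.e. for each $2\le d\le k$ the sums of $d$ of the $\kappa_j$ over the $d$-element subsets of $[n]$ are pairwise distinct. **Cells.** For a full-rank real $k\times n$ matrix $A$ let $\Delta_I(A)$ be its maximal minor in the column set $I\in\binom{[n]}{k}$. The positroid cell $S_{\mathcal M}^{tnn}$ consists of the points of the Grassmannian represented by full-rank $A$ with $\Delta_I(A)>0$ for $I\in\mathcal M$ and $\Delta_J(A)=0$ for $J\notin\mathcal M$. It is irreducible if the reduced row echelon matrix of each of its points has no zero column and each row of it has a nonzero entry besides the pivot. For $r\in[n]$ let $I_r$ be the lexicographically minimal element of $\mathcal M$ for the order $r<r+1<\dots<n<1<\dots<r-1$. The irreducible cell is denoted $S_\pi^{tnn}$, where $\pi\in S_n$ is the derangement such that $I_{i+1}=(I_i\setminus\{i\})\cup\{j\}$ with $j\ne i$ implies $\pi(j)=i$ (indices modulo $n$). **Contour plot.** Put $K_J=\prod_{l<m;\ l,m\in J}(\kappa_m-\kappa_l)$, $E_J=K_J\prod_{j\in J}e^{\kappa_jx+\kappa_j^2y+\kappa_j^3t}$, and $$f_A(x,y,t)=\max_{J:\,\Delta_J(A)>0}\Big\{\ln(\Delta_J(A)K_J)+\sum_{j\in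 J}(\kappa_jx+\kappa_j^2y+\kappa_j^3t)\Big\}.$$ The contour plot $\mathcal C_{t_0}(u_A)$ is the set of points $(x,y)\in\mathbb R^2$ near which $f_A(\cdot,\cdot,t_0)$ is not affine-linear. Its regions are the connected components of its complement; $E_J$ (with $\Delta_J(A)>0$) is the dominant exponential of a region $R$ if $\Delta_I(A)E_I\le\Delta_J(A)E_J$ on $R$ (at $t=t_0$) for all $I$. A line-soliton is an intersection $\overline R\cap\overline{R'}$, with more than one point, of the closures of two distinct regions; it is of type $[i,j]$, $i<j$, if the dominant exponentials of the two regions are $E_{K\cup\{i\}}$ and $E_{K\cup\{j\}}$ for some $K\not\ni i,j$. **Theorem.** Let $A$ represent a point of an irreducible positroid cell $S_\pi^{tnn}$ in $(Gr_{kn})_{\ge0}$, with all maximal minors non-negative, and let $t_0\in\mathbb R$. Then $\pi$ has exactly $k$ excedances and $n-k$ nonexcedances, and the unbounded line-solitons and unbounded regions of $\mathcal C_{t_0}(u_A)$ are as follows. 1. The line-solitons that extend to $y\to+\infty$ are exactly $k$ line-solitons, one of type $[i,\pi(i)]$ for each excedance $\pi(i)>i$. The numbers $\kappa_i+\kappa_{\pi(i)}$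 are distinct, and for all sufficiently large $y$ the horizontal line at height $y$ meets the contour plot in exactly $k$ points, one on each of these solitons, which from left to right are in decreasing order of $\kappa_i+\kappa_{\pi(i)}$; the regions between consecutive points are the same for all such $y$. 2. The line-solitons that extend to $y\to-\infty$ are exactly $n-k$ line-solitons, one of type $[\pi(j),j]$ for each nonexcedance $\pi(j)<j$. The numbers $\kappa_j+\kappa_{\pi(j)}$ are distinct, and for all $y$ sufficiently close to $-\infty$ the horizontal line at height $y$ meets the contour plot in exactly $n-k$ points, one on each of these solitons, which from left to right are in increasing order of $\kappa_j+\kappa_{\pi(j)}$; the regions between consecutive points are the same for all such $y$. 3. One region contains all $(x,y)$ with $x<-C(1+|y|)$ for some constant $C$; it is the leftmost region both for $y\gg0$ and for $y\ll0$, and its dominant exponential is $E_{i_1,\dots,i_k}$, where $i_1,\dots,i_k$ are the excedance positions of $\pi$. Likewise one region contains all $(x,y)$ with $x>C(1+|y|)$ for some $C$ and is the rightmost region both for $y\gg0$ and for $y\ll0$. 4. Each region seen in 1 and 2 has a unique dominant exponential, and these labels are obtained from that of the leftmost region by crossing the solitons from left to right: when a soliton of type $[a,b]$, $a<b$, is crossed,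 the label $J$ satisfies $a\in J$, $b\notin J$ and is replaced by $(J\setminus\{a\})\cup\{b\}$. 5. Every unbounded line-soliton is one of those in 1 or 2, and every unbounded region is one of those seen in 1 or 2. -/

import Mathlib

open Filter Topology

noncomputable section

namespace KPSoliton

variable {k n : ℕ}

/-! ## Positroid cells of the totally non-negative Grassmannian

Points of the Grassmannian are given by full-rank `k × n` matrices; the set `[n]` is `Fin n`. -/

/-- The maximal minor `Δ_I(A)` in the column set `I` (and `0` if `I` does not have `k` elements). -/
def minor (A : Matrix (Fin k) (Fin n) ℝ) (I : Finset (Fin n)) : ℝ :=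
  if h : I.card = k then (A.submatrix id (I.orderEmbOfFin h)).det else 0

/-- The positroid cell `S_M^{tnn}`: full-rank matrices all of whose maximal minors are
non-negative, the positive ones being exactly those indexed by `M`. -/
def positroidCell (k : ℕ) {n : ℕ} (M : Set (Finset (Fin n))) : Set (Matrix (Fin k) (Fin n) ℝ) :=
  {A | A.rank = k ∧ (∀ I ∈ M, 0 < minor A I) ∧ ∀ J, J ∉ M → minor A J = 0}

/-- `B` is a (full-rank) matrix in reduced row echelon form, with the pivot of row `i` in
column `p i`. -/
structure IsReducedEchelon (B : Matrix (Fin k) (Fin n) ℝ) (p : Fin k → Fin n) : Prop where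
  strictMono : StrictMono p
  pivot_eq_one : ∀ i, B i (p i) = 1
  eq_zero_of_lt : ∀ i j, j < p i → B i j = 0
  eq_zero_of_ne : ∀ i i', i' ≠ i → B i' (p i) = 0

/-- The cell of `M` is irreducible: the reduced row echelon matrix of every point has no zero
column, and each of its rows has a nonzero entry besides the pivot. -/
def IsIrreducibleCell (k : ℕ) {n : ℕ} (M : Set (Finset (Fin n))) : Prop :=
  ∀ A ∈ positroidCell k M, ∀ G : Matrix (Fin k) (Fin k) ℝ, IsUnit G →
    ∀ p : Fin k → Fin n, IsReducedEchelon (G * A) p →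
      (∀ j, ∃ i, (G * A) i j ≠ 0) ∧ (∀ i, ∃ j, j ≠ p i ∧ (G * A) i j ≠ 0)

/-- The position (starting from `0`) of `j` in the order `r < r+1 < ⋯ < n < 1 < ⋯ < r-1`. -/
def cyclicRank (r j : Fin n) : ℕ := (j.val + n - r.val) % n

/-- Lexicographic order on subsets of `[n]` of equal size with respect to the order
`r < r+1 < ⋯ < r-1`: the sets agree, or the smallest element in which they differ
belongs to `I`. -/
def LexLE (r : Fin n) (I J : Finset (Fin n)) : Prop :=
  I = J ∨ ∃ a ∈ I \ J, ∀ b ∈ J \ I, cyclicRank r a < cyclicRank r b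

/-- `I = (I_1, …, I_n)` is the Grassmann necklace of `M`: each `I r` is the lexicographically
minimal element of `M` for the order `r < r+1 < ⋯ < r-1`. -/
def IsNecklaceOf (M : Set (Finset (Fin n))) (I : Fin n → Finset (Fin n)) : Prop :=
  ∀ r, I r ∈ M ∧ ∀ J ∈ M, LexLE r (I r) J

/-- `π` is the derangement of the irreducible Grassmann necklace `I`: for each `i`,
`I_{i+1} = (I_i ∖ {i}) ∪ {j}` with `j ≠ i` and `π j = i`. Indices are cyclic
(`finRotate n i` is `i + 1` modulo `n`). -/
def IsPermOfNecklace (I : Fin n → Finset (Fin n)) (π : Equiv.Perm (Fin n)) : Prop :=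
  ∀ i, ∃ j, j ≠ i ∧ I (finRotate n i) = insert j (I i \ {i}) ∧ π j = i

/-- The positroid cell of `M` is the cell `S_π^{tnn}`, that is, `π = π(I(M))`. -/
def IsCellPerm (M : Set (Finset (Fin n))) (π : Equiv.Perm (Fin n)) : Prop :=
  ∃ I, IsNecklaceOf M I ∧ IsPermOfNecklace I π

/-- The excedance positions of `π`. -/
def excedancePositions (π : Equiv.Perm (Fin n)) : Finset (Fin n) :=
  Finset.univ.filter fun i => i < π i

/-- The positions of the nonexcedances of `π`. -/
def nonexcedancePositions (π : Equiv.Perm (Fin n)) : Finset (Fin n) :=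
  Finset.univ.filter fun j => π j < j

/-! ## Exponentials, the function `f_A`, and the contour plot -/

/-- Genericity of the parameters: for `2 ≤ d ≤ k`, the sums of `d` of the `κ_j` are distinct. -/
def GenericParams (k : ℕ) {n : ℕ} (κ : Fin n → ℝ) : Prop :=
  ∀ d, 2 ≤ d → d ≤ k → ∀ I J : Finset (Fin n), I.card = d → J.card = d →
    ∑ i ∈ I, κ i = ∑ j ∈ J, κ j → I = J

/-- `κ_j x + κ_j² y + κ_j³ t`, where `p = (x, y)`. -/
def phase (κ : Fin n → ℝ) (t : ℝ) (j : Fin n) (p : ℝ × ℝ) : ℝ :=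
  κ j * p.1 + κ j ^ 2 * p.2 + κ j ^ 3 * t

/-- `K_J = ∏_{l < m} (κ_{j_m} - κ_{j_l})`. -/
def vandermondeFactor (κ : Fin n → ℝ) (J : Finset (Fin n)) : ℝ :=
  ∏ l ∈ J, ∏ m ∈ J.filter (fun m => l < m), (κ m - κ l)

/-- The exponential `E_J = K_J ∏_{j ∈ J} exp(κ_j x + κ_j² y + κ_j³ t)`. -/
def expE (κ : Fin n → ℝ) (t : ℝ) (J : Finset (Fin n)) (p : ℝ × ℝ) : ℝ :=
  vandermondeFactor κ J * ∏ j ∈ J, Real.exp (phase κ t j p)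

/-- `f_A(x, y, t)`, the maximum over the `J` with `Δ_J(A) > 0` of
`ln(Δ_J(A) K_J) + ∑_{j ∈ J} (κ_j x + κ_j² y + κ_j³ t)`. The index set is finite, and it is
non-empty if `A` belongs to a positroid cell. -/
def fA (κ : Fin n → ℝ) (A : Matrix (Fin k) (Fin n) ℝ) (t : ℝ) (p : ℝ × ℝ) : ℝ :=
  ⨆ J : {J : Finset (Fin n) // 0 < minor A J},
    (Real.log (minor A J.1 * vandermondeFactor κ J.1) + ∑ j ∈ J.1, phase κ t j p)

/-- The contour plot at time `t`: the points of the plane near which `f_A` is not linear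
(in the sense of affine-linear). -/
def contourPlot (κ : Fin n → ℝ) (A : Matrix (Fin k) (Fin n) ℝ) (t : ℝ) : Set (ℝ × ℝ) :=
  {p | ¬ ∃ a b c : ℝ, ∀ᶠ q in 𝓝 p, fA κ A t q = a * q.1 + b * q.2 + c}

/-- `R` is a region of the contour plot: a connected component of its complement. -/
def IsRegion (κ : Fin n → ℝ) (A : Matrix (Fin k) (Fin n) ℝ) (t : ℝ) (R : Set (ℝ × ℝ)) : Prop :=
  ∃ p ∈ (contourPlot κ A t)ᶜ, R = connectedComponentIn (contourPlot κ A t)ᶜ p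

/-- `Δ_J(A) E_J` is a dominant exponential of the `τ`-function `∑_I Δ_I(A) E_I` on `R`. -/
def IsDominantOn (κ : Fin n → ℝ) (A : Matrix (Fin k) (Fin n) ℝ) (t : ℝ) (R : Set (ℝ × ℝ))
    (J : Finset (Fin n)) : Prop :=
  0 < minor A J ∧ ∀ p ∈ R, ∀ I : Finset (Fin n),
    minor A I * expE κ t I p ≤ minor A J * expE κ t J p

/-- `L` is a line-soliton (one of the segments, half-lines or lines making up the contour plot)
separating the two adjacent regions `R` and `R'`. -/
def Separates (κ : Fin n → ℝ) (A : Matrix (Fin k) (Fin n) ℝ) (t : ℝ)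
    (L R R' : Set (ℝ × ℝ)) : Prop :=
  IsRegion κ A t R ∧ IsRegion κ A t R' ∧ R ≠ R' ∧ L = closure R ∩ closure R' ∧ L.Nontrivial

/-- `L` is a line-soliton of the contour plot. -/
def IsLineSoliton (κ : Fin n → ℝ) (A : Matrix (Fin k) (Fin n) ℝ) (t : ℝ)
    (L : Set (ℝ × ℝ)) : Prop :=
  ∃ R R', Separates κ A t L R R'

/-- `L` is a line-soliton of type `[i, j]`, `i < j`: it separates regions with dominant
exponentials `E(i, m_2, …, m_k)` and `E(j, m_2, …, m_k)`. -/
def IsLineSolitonOfType (κ : Fin n → ℝ) (A : Matrix (Fin k) (Fin n) ℝ) (t : ℝ)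
    (i j : Fin n) (L : Set (ℝ × ℝ)) : Prop :=
  i < j ∧ ∃ R R', Separates κ A t L R R' ∧
    ∃ K : Finset (Fin n), i ∉ K ∧ j ∉ K ∧
      IsDominantOn κ A t R (insert i K) ∧ IsDominantOn κ A t R' (insert j K)

/-- `L` extends to infinity in the `y` direction given by `l`, where `l = atTop` (for `y ≫ 0`)
or `l = atBot` (for `y ≪ 0`). -/
def ExtendsAlong (l : Filter ℝ) (L : Set (ℝ × ℝ)) : Prop :=
  ∃ᶠ y in l, ∃ x, (x, y) ∈ L

/-- The description of the contour plot for `y ≫ 0` (`l = atTop`) or `y ≪ 0` (`l = atBot`).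
From left to right one sees the regions `R 0, …, R N`, with dominant exponentials
`J 0, …, J N`. Consecutive regions `R m`, `R (m+1)` are separated by an unbounded line-soliton,
which has type `[a m, b m]`, and these are all the line-solitons that extend to infinity in
the direction considered. -/
structure AsymptoticPicture (κ : Fin n → ℝ) (A : Matrix (Fin k) (Fin n) ℝ) (t : ℝ)
    (l : Filter ℝ) {N : ℕ} (a b : Fin N → Fin n)
    (R : Fin (N + 1) → Set (ℝ × ℝ)) (J : Fin (N + 1) → Finset (Fin n))
    (L : Fin N → Set (ℝ × ℝ)) : Prop where
  region : ∀ m, IsRegion κ A t (R m)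
  /-- `E_{J m}` is the one and only dominant exponential of the region `R m`. -/
  dominant : ∀ m I, IsDominantOn κ A t (R m) I ↔ I = J m
  separates : ∀ m, Separates κ A t (L m) (R m.castSucc) (R m.succ)
  type : ∀ m, IsLineSolitonOfType κ A t (a m) (b m) (L m)
  /-- The labels of the regions are obtained from that of `R 0` by successive exchanges. -/
  exchange : ∀ m, a m ∈ J m.castSucc ∧ b m ∉ J m.castSucc ∧
    J m.succ = insert (b m) (J m.castSucc \ {a m})
  exhaustive : ∀ S, IsLineSoliton κ A t S ∧ ExtendsAlong l S ↔ ∃ m, S = L m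
  /-- The horizontal line at height `y` meets the contour plot exactly in points
  `x 0 < ⋯ < x (N-1)`, the point `x m` lying on `L m` and on no other `L m'`,
  and between `x (m-1)` and `x m` it runs in the region `R m`. -/
  slice : ∀ᶠ y in l, ∃ x : Fin N → ℝ, StrictMono x ∧
    {s | (s, y) ∈ contourPlot κ A t} = Set.range x ∧
    (∀ m s, (s, y) ∈ L m ↔ s = x m) ∧
    (∀ m : Fin (N + 1), ∀ s : ℝ, (∀ j : Fin N, j.castSucc < m → x j < s) →
      (∀ j : Fin N, m ≤ j.castSucc → s < x j) → (s, y) ∈ R m)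

end KPSoliton

end

/-! The function `fA` is a maximum of finitely many affine functions of `(x, y)`, one for each basis
`J` of the columns of `A`, and genericity makes their `x`-slopes `∑ κ_j` distinct. So the regions
are the nonempty convex open cells on which one function is strictly maximal (`compl_kinks`,
`connectedComponentIn_cell`). For `ε = ±1` and `ε * y` large, put `x = u * |y|`: the order of the
functions is then governed by the one-variable upper envelope of `u ↦ ∑_{j ∈ J} (κ_j u + ε κ_j²)`,
while the constant terms only shift each break point by a bounded amount
(`IsEnvelope.eventually_isSlice`).

For fixed `u`, the maximal `J` are the maximum-weight bases of a linear matroid whose weights are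
values of a quadratic at the `κ_m`. Two weights agree only at `u = -ε * (κ a + κ b)`, and by
genericity two maximal bases then differ by the single exchange of `a` and `b`. In terms of spans,
the exchange is possible exactly when one of the two vectors is outside the span of the heavier
vectors and enters it once the other vector is added.

The link with `π` is that the heavier indices form a cyclic interval `between i j` (`between_eq`),
while the Grassmann necklace says that `π j = i` precisely when `v i` is outside the span of
`between i j` and inside it after `j` is added (`perm_spec`, `perm_eq_of_span`). Hence the break
points are the numbers `-ε * (κ j + κ (π j))` over the excedances for `ε = 1` and over the
nonexcedances for `ε = -1` (`exists_chain`).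

The bases of extreme `x`-slope begin and end both envelopes, and their cells contain cones around
the horizontal directions. The greedy basis of least slope is the set of excedance positions
(`mem_iff_excedance`). A line-soliton or region that is bounded in `y` is either bounded or, for a
region, meets one of these cones. -/

namespace KPSoliton

/-! ### Cells of a maximum of finitely many affine functions of the plane. -/

section Planes

variable {ι : Type*}

/-- The affine function `s i * x + q i * y + c i` of the plane. -/
def plane (s q c : ι → ℝ) (i : ι) (p : ℝ × ℝ) : ℝ := s i * p.1 + q i * p.2 + c i

/-- The open cell on which the `i`-th affine function is the strict maximum. -/
def cell (s q c : ι → ℝ) (i : ι) : Set (ℝ × ℝ) :=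
  {p | ∀ j, j ≠ i → plane s q c j p < plane s q c i p}

/-- The closed cell on which the `i`-th affine function attains the maximum. -/
def closedCell (s q c : ι → ℝ) (i : ι) : Set (ℝ × ℝ) :=
  {p | ∀ j, plane s q c j p ≤ plane s q c i p}

/-- The points near which `f` is not affine. -/
def kinks (f : ℝ × ℝ → ℝ) : Set (ℝ × ℝ) :=
  {p | ¬ ∃ a b c : ℝ, ∀ᶠ q in 𝓝 p, f q = a * q.1 + b * q.2 + c}

variable {s q c : ι → ℝ}

theorem continuous_plane (i : ι) : Continuous (plane s q c i) := by
  unfold plane; fun_prop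

theorem cell_subset_closedCell (i : ι) : cell s q c i ⊆ closedCell s q c i := by
  intro p hp j
  rcases eq_or_ne j i with rfl | h
  · exact le_rfl
  · exact (hp j h).le

theorem eq_of_mem_cell_of_mem_closedCell {i j : ι} {p : ℝ × ℝ} (hi : p ∈ cell s q c i)
    (hj : p ∈ closedCell s q c j) : j = i := by
  by_contra h
  exact absurd (hj i) (not_le.2 (hi j h))

theorem iSup_plane_eq {i : ι} {p : ℝ × ℝ} (hp : p ∈ closedCell s q c i) :
    ⨆ j, plane s q c j p = plane s q c i p := by
  have : Nonempty ι := ⟨i⟩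
  exact le_antisymm (ciSup_le hp)
    (le_ciSup (f := fun j => plane s q c j p) ⟨plane s q c i p, by rintro _ ⟨j, rfl⟩; exact hp j⟩ i)

theorem isOpen_cell [Finite ι] (i : ι) : IsOpen (cell s q c i) := by
  have : cell s q c i = ⋂ j, {p | j ≠ i → plane s q c j p < plane s q c i p} := by
    ext p; simp [cell]
  rw [this]
  refine isOpen_iInter_of_finite fun j => ?_
  by_cases h : j = i
  · simp [h]
  · simpa [h] using isOpen_lt (continuous_plane j) (continuous_plane i)

theorem isClosed_closedCell (i : ι) : IsClosed (closedCell s q c i) := by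
  have : closedCell s q c i = ⋂ j, {p | plane s q c j p ≤ plane s q c i p} := by
    ext p; simp [closedCell]
  rw [this]
  exact isClosed_iInter fun j => isClosed_le (continuous_plane j) (continuous_plane i)

theorem plane_combo (i : ι) (p p' : ℝ × ℝ) {a b : ℝ} (hab : a + b = 1) :
    plane s q c i (a • p + b • p') = a * plane s q c i p + b * plane s q c i p' := by
  simp only [plane, Prod.fst_add, Prod.snd_add, Prod.smul_fst, Prod.smul_snd, smul_eq_mul]
  linear_combination (-c i) * hab

theorem convex_cell (i : ι) : Convex ℝ (cell s q c i) := by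
  intro p hp p' hp' a b ha hb hab j hj
  rw [plane_combo j p p' hab, plane_combo i p p' hab]
  have h1 := hp j hj
  have h2 := hp' j hj
  rcases ha.eq_or_lt with rfl | ha
  · obtain rfl : b = 1 := by linarith
    linarith
  · have := mul_lt_mul_of_pos_left h1 ha
    have := mul_le_mul_of_nonneg_left h2.le hb
    linarith

/-- A segment from a point of the closed cell to a point of the open cell has its interior in the
open cell, because one of the averaged inequalities is strict. Nonemptiness matters, since a closed
cell can be a segment or a point. -/
theorem closure_cell {i : ι} (h : (cell s q c i).Nonempty) :
    closure (cell s q c i) = closedCell s q c i := by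
  refine subset_antisymm
    (closure_minimal (cell_subset_closedCell i) (isClosed_closedCell i)) fun p hp => ?_
  obtain ⟨p', hp'⟩ := h
  have hsub : openSegment ℝ p p' ⊆ cell s q c i := by
    rintro _ ⟨a, b, ha, hb, hab, rfl⟩ j hj
    rw [plane_combo j p p' hab, plane_combo i p p' hab]
    have := mul_lt_mul_of_pos_left (hp' j hj) hb
    have := mul_le_mul_of_nonneg_left (hp j) ha.le
    linarith
  have := closure_mono hsub
  rw [closure_openSegment] at this
  exact this (left_mem_segment ℝ p p')

/-- An affine minorant touching `f` at `p` has `s i - a` times every small horizontal displacement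
nonpositive; displacements of both signs force equality. -/
theorem slope_eq_of_eventually_le {f : ℝ × ℝ → ℝ} {p : ℝ × ℝ} {a b d : ℝ}
    (hf : ∀ᶠ r in 𝓝 p, f r = a * r.1 + b * r.2 + d) {i : ι}
    (hle : ∀ r, plane s q c i r ≤ f r) (heq : plane s q c i p = f p) : s i = a := by
  have hp : f p = a * p.1 + b * p.2 + d := hf.self_of_nhds
  have hc : Tendsto (fun h : ℝ => (p.1 + h, p.2)) (𝓝 0) (𝓝 p) := by
    have : Continuous (fun h : ℝ => (p.1 + h, p.2)) := by fun_prop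
    simpa using this.tendsto 0
  have he := hc.eventually hf
  obtain ⟨δ, hδ, hball⟩ := Metric.eventually_nhds_iff.1 he
  have key : ∀ h : ℝ, |h| < δ → (s i - a) * h ≤ 0 := by
    intro h hh
    have h1 := hball (y := h) (by simpa using hh)
    have h2 := hle (p.1 + h, p.2)
    simp only [plane] at h1 h2 heq
    nlinarith
  have h1 := key (δ / 2) (by rw [abs_of_pos (by linarith)]; linarith)
  have h2 := key (-(δ / 2)) (by rw [abs_neg, abs_of_pos (by linarith)]; linarith)
  nlinarith

/-- Where the maximum is locally affine, every maximal function has the `x`-slope of that affine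
germ. Distinct slopes therefore leave only one maximal function. -/
theorem compl_kinks [Finite ι] [Nonempty ι] (hs : Function.Injective s) :
    (kinks fun p => ⨆ i, plane s q c i p)ᶜ = ⋃ i, cell s q c i := by
  ext p
  simp only [kinks, Set.mem_compl_iff, Set.mem_ofPred_eq, not_not, Set.mem_iUnion]
  constructor
  · rintro ⟨a, b, d, hf⟩
    have hle : ∀ j r, plane s q c j r ≤ ⨆ i, plane s q c i r := fun j r =>
      le_ciSup (f := fun i => plane s q c i r) (Set.finite_range _).bddAbove j
    obtain ⟨i, hi⟩ := Finite.exists_max fun i => plane s q c i p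
    have hi' := iSup_plane_eq (s := s) (q := q) (c := c) (p := p) (i := i) hi
    refine ⟨i, fun j hj => lt_of_le_of_ne (hi j) fun h => hj (hs ?_)⟩
    rw [slope_eq_of_eventually_le hf (hle j) (h.trans hi'.symm),
      slope_eq_of_eventually_le hf (hle i) hi'.symm]
  · rintro ⟨i, hi⟩
    refine ⟨s i, q i, c i, ?_⟩
    filter_upwards [(isOpen_cell i).mem_nhds hi] with r hr
    exact iSup_plane_eq (cell_subset_closedCell i hr)

/-- The cell is convex, and the other cells form an open set disjoint from it, so a connected set
meeting the cell cannot leave it. -/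
theorem connectedComponentIn_cell [Finite ι] {i : ι} {p : ℝ × ℝ} (hp : p ∈ cell s q c i) :
    connectedComponentIn (⋃ i, cell s q c i) p = cell s q c i := by
  refine subset_antisymm ?_ ((convex_cell i).isPreconnected.subset_connectedComponentIn hp
    (Set.subset_iUnion _ i))
  refine IsPreconnected.subset_left_of_subset_union (isOpen_cell i)
    (isOpen_iUnion fun j : {j // j ≠ i} => isOpen_cell (s := s) (q := q) (c := c) j.1) ?_ ?_ ⟨p, mem_connectedComponentIn
      (Set.mem_iUnion.2 ⟨i, hp⟩), hp⟩ isPreconnected_connectedComponentIn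
  · rw [Set.disjoint_iUnion_right]
    rintro ⟨j, hj⟩
    rw [Set.disjoint_left]
    intro r hr hr'
    exact hj (eq_of_mem_cell_of_mem_closedCell hr (cell_subset_closedCell j hr'))
  · refine (connectedComponentIn_subset _ _).trans fun r hr => ?_
    obtain ⟨j, hj⟩ := Set.mem_iUnion.1 hr
    by_cases h : j = i
    · exact Or.inl (h ▸ hj)
    · exact Or.inr (Set.mem_iUnion.2 ⟨⟨j, h⟩, hj⟩)

theorem mem_kinks_iff [Finite ι] [Nonempty ι] (hs : Function.Injective s) {p : ℝ × ℝ} :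
    (p ∈ kinks fun p => ⨆ i, plane s q c i p) ↔ ∀ i, p ∉ cell s q c i := by
  rw [← not_iff_not, ← Set.mem_compl_iff, compl_kinks hs]
  simp

theorem not_mem_cell_of_mem_inter {i j k : ι} (hij : i ≠ j) {p : ℝ × ℝ}
    (hi : p ∈ closedCell s q c i) (hj : p ∈ closedCell s q c j) : p ∉ cell s q c k := by
  intro hk
  exact hij ((eq_of_mem_cell_of_mem_closedCell hk hi).trans
    (eq_of_mem_cell_of_mem_closedCell hk hj).symm)

/-! ### Horizontal slices and their asymptotics. -/

/-- The horizontal line at height `y` is cut by the points `x 0 < x 1 < ⋯`, at which exactly the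
consecutive functions of the sequence `J` tie for the maximum. -/
structure IsSlice (s q c : ι → ℝ) {N : ℕ} (J : Fin (N + 1) → ι) (y : ℝ) (x : Fin N → ℝ) :
    Prop where
  strictMono : StrictMono x
  tie : ∀ m, plane s q c (J m.castSucc) (x m, y) = plane s q c (J m.succ) (x m, y)
  lt : ∀ m i, i ≠ J m.castSucc → i ≠ J m.succ →
    plane s q c i (x m, y) < plane s q c (J m.castSucc) (x m, y)

/-- The sequence `J` is the upper envelope of the functions `v ↦ s i * v + ε * q i`, with break
points `u`, at each of which only two of the functions are maximal. -/
structure IsEnvelope (s q : ι → ℝ) (ε : ℝ) {N : ℕ} (u : Fin N → ℝ) (J : Fin (N + 1) → ι) :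
    Prop where
  slope_lt : ∀ m : Fin N, s (J m.castSucc) < s (J m.succ)
  slope_min : ∀ i, s (J 0) ≤ s i
  slope_max : ∀ i, s i ≤ s (J (Fin.last N))
  tie : ∀ m : Fin N, s (J m.castSucc) * u m + ε * q (J m.castSucc)
    = s (J m.succ) * u m + ε * q (J m.succ)
  lt : ∀ (m : Fin N) i, i ≠ J m.castSucc → i ≠ J m.succ →
    s i * u m + ε * q i < s (J m.castSucc) * u m + ε * q (J m.castSucc)

variable {N : ℕ} {J : Fin (N + 1) → ι} {ε : ℝ} {u : Fin N → ℝ}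

theorem eventually_pos_of_tendsto {l : Filter ℝ} (hl : Tendsto (fun y => ε * y) l atTop)
    {α : ℝ} (hα : 0 < α) (β : ℝ) : ∀ᶠ y in l, 0 < α * (ε * y) + β := by
  have : Tendsto (fun y => α * (ε * y) + β) l atTop :=
    tendsto_atTop_add_const_right _ _ (hl.const_mul_atTop hα)
  exact this.eventually_gt_atTop 0

/-- The cut points are `u m * (ε * y) + d m`, with `d m` chosen to balance the constant terms of the
two tying functions. As `ε² = 1` gives `q * y = (ε * q) * (ε * y)`, each strict inequality of the
envelope becomes the positive leading coefficient of an affine function of `ε * y`, which is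
eventually positive. -/
theorem IsEnvelope.eventually_isSlice [Finite ι] (hJ : IsEnvelope s q ε u J) (hu : StrictMono u)
    (hε : ε * ε = 1) {l : Filter ℝ} (hl : Tendsto (fun y => ε * y) l atTop) :
    ∀ᶠ y in l, ∃ x, IsSlice s q c J y x := by
  set d : Fin N → ℝ := fun m =>
    -(c (J m.succ) - c (J m.castSucc)) / (s (J m.succ) - s (J m.castSucc)) with hd
  have hd' : ∀ m, d m * (s (J m.succ) - s (J m.castSucc)) =
      -(c (J m.succ) - c (J m.castSucc)) := fun m =>
    div_mul_cancel₀ _ (sub_pos.2 (hJ.slope_lt m)).ne'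
  have e1 : ∀ᶠ y in l, ∀ m m' : Fin N, m < m' →
      0 < (u m' - u m) * (ε * y) + (d m' - d m) := by
    refine eventually_all.2 fun m => eventually_all.2 fun m' => ?_
    by_cases h : m < m'
    · filter_upwards [eventually_pos_of_tendsto hl (sub_pos.2 (hu h)) (d m' - d m)] with y hy _
        using hy
    · exact Eventually.of_forall fun y h' => absurd h' h
  have e2 : ∀ᶠ y in l, ∀ (m : Fin N) (i : ι), i ≠ J m.castSucc → i ≠ J m.succ →
      0 < (s (J m.castSucc) * u m + ε * q (J m.castSucc) - (s i * u m + ε * q i)) * (ε * y)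
        + ((s (J m.castSucc) - s i) * d m + (c (J m.castSucc) - c i)) := by
    refine eventually_all.2 fun m => eventually_all.2 fun i => ?_
    by_cases h : i ≠ J m.castSucc ∧ i ≠ J m.succ
    · filter_upwards [eventually_pos_of_tendsto hl (sub_pos.2 (hJ.lt m i h.1 h.2))
        ((s (J m.castSucc) - s i) * d m + (c (J m.castSucc) - c i))] with y hy _ _ using hy
    · exact Eventually.of_forall fun y h1 h2 => absurd ⟨h1, h2⟩ h
  filter_upwards [e1, e2] with y h1 h2
  refine ⟨fun m => u m * (ε * y) + d m, ?_, ?_, ?_⟩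
  · intro m m' h
    have := h1 m m' h
    simp only
    linarith
  · intro m
    have h3 := hJ.tie m
    have h4 := hd' m
    simp only [plane]
    linear_combination (ε * y) * h3 - h4 + (q (J m.succ) - q (J m.castSucc)) * y * hε
  · intro m i hi hi'
    have := h2 m i hi hi'
    simp only [plane]
    have e : (ε * q (J m.castSucc) - ε * q i) * (ε * y) = (q (J m.castSucc) - q i) * y := by
      linear_combination ((q (J m.castSucc) - q i) * y) * hε
    linarith

theorem plane_fst_sub (i j : ι) (x x' y : ℝ) :
    (plane s q c j (x', y) - plane s q c i (x', y)) =
      (plane s q c j (x, y) - plane s q c i (x, y)) + (s j - s i) * (x' - x) := by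
  simp only [plane]; ring

theorem IsSlice.le_left {y : ℝ} {x : Fin N → ℝ} (hx : IsSlice s q c J y x) (m : Fin N) (i : ι) :
    plane s q c i (x m, y) ≤ plane s q c (J m.castSucc) (x m, y) := by
  by_cases h : i = J m.castSucc
  · rw [h]
  by_cases h' : i = J m.succ
  · rw [h', hx.tie m]
  exact (hx.lt m i h h').le

theorem IsSlice.le_right {y : ℝ} {x : Fin N → ℝ} (hx : IsSlice s q c J y x) (m : Fin N) (i : ι) :
    plane s q c i (x m, y) ≤ plane s q c (J m.succ) (x m, y) :=
  (hx.le_left m i).trans (hx.tie m).le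

/-- A function of smaller slope does not exceed `J m` at the cut point on the left and loses ground
moving right; one of larger slope is handled from the cut point on the right. At the two ends no
such function exists. -/
theorem IsSlice.mem_cell (hs : Function.Injective s) {y : ℝ} {x : Fin N → ℝ}
    (hx : IsSlice s q c J y x) (hmin : ∀ i, s (J 0) ≤ s i)
    (hmax : ∀ i, s i ≤ s (J (Fin.last N))) (m : Fin (N + 1)) (r : ℝ)
    (hl : ∀ j : Fin N, j.castSucc < m → x j < r) (hr : ∀ j : Fin N, m ≤ j.castSucc → r < x j) :
    (r, y) ∈ cell s q c (J m) := by
  intro i hi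
  have hne : s i ≠ s (J m) := fun h => hi (hs h)
  rcases lt_or_gt_of_ne hne with h | h
  · rcases Fin.eq_zero_or_eq_succ m with rfl | ⟨j, rfl⟩
    · exact absurd (hmin i) (not_le.2 h)
    · have h1 := hx.le_right j i
      have h2 := hl j (Fin.castSucc_lt_succ)
      have h3 := plane_fst_sub (s := s) (q := q) (c := c) (J j.succ) i (x j) r y
      nlinarith
  · rcases Fin.eq_castSucc_or_eq_last m with ⟨j, rfl⟩ | rfl
    · have h1 := hx.le_left j i
      have h2 := hr j le_rfl
      have h3 := plane_fst_sub (s := s) (q := q) (c := c) (J j.castSucc) i (x j) r y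
      nlinarith
    · exact absurd (hmax i) (not_le.2 h)

theorem exists_gap {x : Fin N → ℝ} (hx : StrictMono x) {r : ℝ} (hr : r ∉ Set.range x) :
    ∃ m : Fin (N + 1), (∀ j : Fin N, j.castSucc < m → x j < r) ∧
      ∀ j : Fin N, m ≤ j.castSucc → r < x j := by
  by_cases h : ∃ j, r < x j
  · obtain ⟨j, hj, hmin⟩ := WellFounded.has_min (wellFounded_lt (α := Fin N)) {j | r < x j} h
    refine ⟨j.castSucc, fun i hi => ?_, fun i hi => ?_⟩
    · have : ¬ r < x i := fun h' => hmin i h' (by simpa using hi)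
      exact lt_of_le_of_ne (not_lt.1 this) fun h' => hr ⟨i, h'⟩
    · exact lt_of_lt_of_le hj (hx.monotone (by simpa using hi))
  · push Not at h
    exact ⟨Fin.last N, fun j _ => lt_of_le_of_ne (h j) fun h' => hr ⟨j, h'⟩,
      fun j hj => absurd hj (not_le.2 (Fin.castSucc_lt_last j))⟩

/-- Every point of the slice is one of the cut points or lies in the open cell of a member of `J`. -/
theorem IsSlice.cases (hs : Function.Injective s) {y : ℝ} {x : Fin N → ℝ}
    (hx : IsSlice s q c J y x) (hmin : ∀ i, s (J 0) ≤ s i)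
    (hmax : ∀ i, s i ≤ s (J (Fin.last N))) (r : ℝ) :
    (∃ m, r = x m) ∨ ∃ m, (r, y) ∈ cell s q c (J m) := by
  by_cases h : r ∈ Set.range x
  · obtain ⟨m, hm⟩ := h
    exact Or.inl ⟨m, hm.symm⟩
  · obtain ⟨m, h1, h2⟩ := exists_gap hx.strictMono h
    exact Or.inr ⟨m, hx.mem_cell hs hmin hmax m r h1 h2⟩

theorem IsSlice.eq_or_eq {y : ℝ} {x : Fin N → ℝ} (hx : IsSlice s q c J y x) {m : Fin N} {i : ι}
    (hi : (x m, y) ∈ closedCell s q c i) : i = J m.castSucc ∨ i = J m.succ := by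
  by_contra! h
  exact absurd (hi (J m.castSucc)) (not_le.2 (hx.lt m i h.1 h.2))

end Planes

/-! ### Upper envelopes in one variable. -/

section Envelope

variable {ι : Type*} [Finite ι] {s g : ι → ℝ}

/-- A maximal function of largest slope at `v` stays maximal up to the next point at which two
functions are maximal. -/
theorem isMax_of_no_tie {v v' : ℝ} {j : ι} (hj : ∀ i, s i * v + g i ≤ s j * v + g j)
    (hj' : ∀ i, s j < s i → s i * v + g i < s j * v + g j) (hv : v ≤ v')
    (hno : ∀ r, v < r → r < v' → ∀ i i', (∀ h, s h * r + g h ≤ s i * r + g i) →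
      (∀ h, s h * r + g h ≤ s i' * r + g i') → i = i') :
    ∀ i, s i * v' + g i ≤ s j * v' + g j := by
  by_contra! hcon
  obtain ⟨i₁, hi₁⟩ := hcon
  have hs₁ : s j < s i₁ := by
    by_contra! h
    have := hj i₁
    nlinarith
  set cr : {i // s j < s i} → ℝ := fun i => (g j - g i.1) / (s i.1 - s j) with hcr
  have hcr' : ∀ i : {i // s j < s i}, cr i * (s i.1 - s j) = g j - g i.1 := fun i =>
    div_mul_cancel₀ _ (sub_pos.2 i.2).ne'
  have : Nonempty {i // s j < s i} := ⟨⟨i₁, hs₁⟩⟩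
  obtain ⟨i₀, hi₀⟩ := Finite.exists_min cr
  have hlt : cr i₀ < v' := by
    refine (hi₀ ⟨i₁, hs₁⟩).trans_lt ?_
    have := hcr' ⟨i₁, hs₁⟩
    have h0 : 0 < s i₁ - s j := sub_pos.2 hs₁
    simp only at this
    nlinarith
  have hgt : v < cr i₀ := by
    have := hcr' i₀
    have h1 := hj' i₀.1 i₀.2
    have h0 : 0 < s i₀.1 - s j := sub_pos.2 i₀.2
    nlinarith
  have hmax : ∀ h, s h * cr i₀ + g h ≤ s j * cr i₀ + g j := by
    intro h
    by_cases hh : s j < s h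
    · have h1 := hi₀ ⟨h, hh⟩
      have h2 := hcr' ⟨h, hh⟩
      have h0 : 0 < s h - s j := sub_pos.2 hh
      simp only at h2
      nlinarith
    · have := hj h
      nlinarith
  have htie : s i₀.1 * cr i₀ + g i₀.1 = s j * cr i₀ + g j := by
    have := hcr' i₀
    linarith
  have := hno _ hgt hlt j i₀.1 hmax (fun h => (hmax h).trans htie.ge)
  have h2 := i₀.2
  rw [← this] at h2
  exact lt_irrefl _ h2

theorem exists_isMax_max_slope [Nonempty ι] (v : ℝ) :
    ∃ j, (∀ i, s i * v + g i ≤ s j * v + g j) ∧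
      ∀ i, s j < s i → s i * v + g i < s j * v + g j := by
  obtain ⟨j₀, hj₀⟩ := Finite.exists_max fun i => s i * v + g i
  have : Nonempty {j // ∀ i, s i * v + g i ≤ s j * v + g j} := ⟨⟨j₀, hj₀⟩⟩
  obtain ⟨j, hj⟩ := Finite.exists_max fun j : {j // ∀ i, s i * v + g i ≤ s j * v + g j} => s j.1
  refine ⟨j.1, j.2, fun i hi => lt_of_le_of_ne (j.2 i) fun h => ?_⟩
  exact absurd (hj ⟨i, fun i' => (j.2 i').trans h.ge⟩) (not_le.2 hi)

/-- Near `-∞` the function of least slope dominates. This supplies a starting point for the envelope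
to the left of all break points. -/
theorem exists_lt_isMax_min_slope [Nonempty ι] (hs : Function.Injective s) (b : ℝ) :
    ∃ v < b, ∃ j, (∀ i, s j ≤ s i) ∧ (∀ i, s i * v + g i ≤ s j * v + g j) ∧
      ∀ i, s j < s i → s i * v + g i < s j * v + g j := by
  obtain ⟨j, hj⟩ := Finite.exists_min s
  have key : ∀ᶠ v in atBot, v < b ∧ ∀ i, s j < s i → s i * v + g i < s j * v + g j := by
    refine (eventually_lt_atBot b).and (eventually_all.2 fun i => ?_)
    by_cases h : s j < s i
    · filter_upwards [eventually_lt_atBot ((g j - g i) / (s i - s j))] with v hv _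
      rw [lt_div_iff₀ (sub_pos.2 h)] at hv
      linarith
    · exact Eventually.of_forall fun v h' => absurd h' h
  obtain ⟨v, hv, h⟩ := key.exists
  refine ⟨v, hv, j, hj, fun i => ?_, h⟩
  rcases (hj i).eq_or_lt with h' | h'
  · rw [hs h']
  · exact (h i h').le

/-- The upper envelope of finitely many affine functions with distinct slopes, at most two of which
are maximal at the same point. -/
theorem exists_isEnvelope [Nonempty ι] {q : ι → ℝ} {ε : ℝ} (hs : Function.Injective s) {N : ℕ}
    {u : Fin N → ℝ} (hu : StrictMono u)
    (htie : ∀ v, (∃ m, v = u m) ↔ ∃ i j, i ≠ j ∧ (∀ h, s h * v + ε * q h ≤ s i * v + ε * q i) ∧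
      ∀ h, s h * v + ε * q h ≤ s j * v + ε * q j)
    (htwo : ∀ v i j h, i ≠ j → (∀ h, s h * v + ε * q h ≤ s i * v + ε * q i) →
      (∀ h, s h * v + ε * q h ≤ s j * v + ε * q j) →
      (∀ h', s h' * v + ε * q h' ≤ s h * v + ε * q h) → h = i ∨ h = j) :
    ∃ J : Fin (N + 1) → ι, IsEnvelope s q ε u J := by
  obtain ⟨b, hb⟩ : ∃ b, ∀ m, b < u m := by
    obtain ⟨b, hb⟩ := (Set.finite_range u).bddBelow
    exact ⟨b - 1, fun m => by have := hb ⟨m, rfl⟩; linarith⟩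
  obtain ⟨w, hw, j₀, hmin, hj₀, hj₀'⟩ :=
    exists_lt_isMax_min_slope (s := s) (g := fun i => ε * q i) hs b
  -- `J m` is chosen at the left end of its interval: at `w` for `m = 0`, and otherwise as the
  -- steepest maximal function at the preceding break point.
  set v : Fin (N + 1) → ℝ := Fin.cons w u with hv
  have hvs : ∀ m, v m.succ = u m := fun m => by simp [hv]
  have hvmono : StrictMono v := by
    refine Fin.strictMono_iff_lt_succ.2 fun m => ?_
    rw [hvs]
    rcases Fin.eq_zero_or_eq_succ m.castSucc with h | ⟨j, h⟩
    · rw [h]; simpa [hv] using hw.trans (hb m)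
    · rw [h, hvs]
      refine hu ?_
      have : (j.succ : ℕ) = m.castSucc := by rw [h]
      simp only [Fin.val_succ, Fin.val_castSucc] at this
      exact Fin.lt_def.2 (by omega)
  have hex : ∀ m, ∃ j, (∀ i, s i * v m + ε * q i ≤ s j * v m + ε * q j) ∧
      (∀ i, s j < s i → s i * v m + ε * q i < s j * v m + ε * q j) ∧
      (m = 0 → ∀ i, s j ≤ s i) := by
    intro m
    by_cases h : m = 0
    · subst h
      exact ⟨j₀, by simpa [hv] using hj₀, by simpa [hv] using hj₀', fun _ => hmin⟩
    · obtain ⟨j, h1, h2⟩ := exists_isMax_max_slope (s := s) (g := fun i => ε * q i) (v m)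
      exact ⟨j, h1, h2, fun h' => absurd h' h⟩
  choose J hJ hJ' hJ0 using hex
  have hno : ∀ r, (∀ m, r ≠ u m) → ∀ i i', (∀ h, s h * r + ε * q h ≤ s i * r + ε * q i) →
      (∀ h, s h * r + ε * q h ≤ s i' * r + ε * q i') → i = i' := by
    intro r hr i i' h1 h2
    by_contra hne
    obtain ⟨m, hm⟩ := (htie r).2 ⟨i, i', hne, h1, h2⟩
    exact hr m hm
  have hcast : ∀ m : Fin N, ∀ i,
      s i * u m + ε * q i ≤ s (J m.castSucc) * u m + ε * q (J m.castSucc) := by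
    intro m
    have hlt : v m.castSucc < u m := by
      rw [← hvs]; exact hvmono Fin.castSucc_lt_succ
    refine isMax_of_no_tie (g := fun i => ε * q i) (hJ m.castSucc) (hJ' m.castSucc) hlt.le ?_
    intro r h1 h2
    refine hno r ?_
    rintro m' rfl
    rw [← hvs] at h1 h2
    rw [← hvs] at h2
    have h3 := hvmono.lt_iff_lt.1 h1
    have h4 := hvmono.lt_iff_lt.1 h2
    rw [Fin.lt_def] at h3 h4
    simp at h3 h4
    omega
  have hsucc : ∀ m : Fin N, ∀ i,
      s i * u m + ε * q i ≤ s (J m.succ) * u m + ε * q (J m.succ) := by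
    intro m; rw [← hvs]; exact hJ m.succ
  have htie' : ∀ m : Fin N, s (J m.castSucc) * u m + ε * q (J m.castSucc)
      = s (J m.succ) * u m + ε * q (J m.succ) :=
    fun m => le_antisymm (hsucc m _) (hcast m _)
  have hslope : ∀ m : Fin N, s (J m.castSucc) < s (J m.succ) := by
    intro m
    obtain ⟨i, i', hne, hi, hi'⟩ := (htie (u m)).1 ⟨m, rfl⟩
    have hlt : v m.castSucc < u m := by
      rw [← hvs]; exact hvmono Fin.castSucc_lt_succ
    -- a function that is maximal at `u m` has slope at least that of `J m.castSucc`
    have key : ∀ h, (∀ h', s h' * u m + ε * q h' ≤ s h * u m + ε * q h) →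
        s (J m.castSucc) ≤ s h ∧ s h ≤ s (J m.succ) := by
      intro h hh
      constructor
      · have h1 := hJ m.castSucc h
        have h2 := le_antisymm (hcast m h) (hh (J m.castSucc))
        nlinarith
      · by_contra! hcon
        have h1 := hJ' m.succ h hcon
        rw [hvs] at h1
        exact absurd (hh (J m.succ)) (not_le.2 h1)
    -- All slopes maximal at `u m` lie between the two consecutive slopes; if these coincided, the
    -- two distinct tying functions would have equal slope.
    refine lt_of_le_of_ne (key _ (hsucc m)).1 fun heq => hne (hs ?_)
    have h1 := key i hi
    have h2 := key i' hi'
    linarith [h1.1, h1.2, h2.1, h2.2]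
  refine ⟨J, hslope, hJ0 0 rfl, ?_, htie', ?_⟩
  · intro i
    by_contra! hcon
    -- A point beyond the last break point and beyond the place where the steeper `i` would overtake
    -- the last member of `J`.
    set z : ℝ := max (v (Fin.last N))
      ((ε * q (J (Fin.last N)) - ε * q i) / (s i - s (J (Fin.last N)))) + 1 with hz
    have hz1 : v (Fin.last N) < z := by
      have := le_max_left (v (Fin.last N))
        ((ε * q (J (Fin.last N)) - ε * q i) / (s i - s (J (Fin.last N))))
      linarith
    have hz2 : (ε * q (J (Fin.last N)) - ε * q i) / (s i - s (J (Fin.last N))) < z := by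
      have := le_max_right (v (Fin.last N))
        ((ε * q (J (Fin.last N)) - ε * q i) / (s i - s (J (Fin.last N))))
      linarith
    rw [div_lt_iff₀ (sub_pos.2 hcon)] at hz2
    have := isMax_of_no_tie (g := fun i => ε * q i) (hJ (Fin.last N)) (hJ' (Fin.last N)) hz1.le
      (fun r h1 _ => hno r (by
        rintro m rfl
        rw [← hvs] at h1
        exact absurd (hvmono.lt_iff_lt.1 h1) (not_lt.2 (Fin.le_last _)))) i
    linarith
  · intro m i h1 h2
    refine lt_of_le_of_ne (hcast m i) fun h => ?_
    rcases htwo (u m) (J m.castSucc) (J m.succ) i (fun h => (hslope m).ne (by rw [h]))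
      (hcast m) (hsucc m) (fun h' => (hcast m h').trans h.ge) with h | h
    · exact h1 h
    · exact h2 h

end Envelope

/-! ### Maximum-weight bases of a vector configuration. -/

section LinearMatroid

open Module

variable {α V : Type*} [AddCommGroup V] [Module ℝ V] {v : α → V}

/-- The finite sets indexing a basis of the space among the vectors `v`. -/
def IsBase (v : α → V) (J : Finset α) : Prop :=
  LinearIndepOn ℝ v (J : Set α) ∧ J.card = finrank ℝ V

/-- The bases of maximal weight. -/
def IsMaxBase (v : α → V) (w : α → ℝ) (J : Finset α) : Prop :=
  IsBase v J ∧ ∀ J', IsBase v J' → ∑ m ∈ J', w m ≤ ∑ m ∈ J, w m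

/-- The span of the vectors with index in `S`. -/
abbrev spanOf (v : α → V) (S : Set α) : Submodule ℝ V := Submodule.span ℝ (v '' S)

theorem spanOf_mono {S T : Set α} (h : S ⊆ T) : spanOf v S ≤ spanOf v T :=
  Submodule.span_mono (Set.image_mono h)

theorem mem_spanOf {S : Set α} {m : α} (h : m ∈ S) : v m ∈ spanOf v S :=
  Submodule.subset_span ⟨m, h, rfl⟩

theorem spanOf_le {S : Set α} {W : Submodule ℝ V} (h : ∀ m ∈ S, v m ∈ W) : spanOf v S ≤ W := by
  refine Submodule.span_le.2 ?_
  rintro _ ⟨m, hm, rfl⟩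
  exact h m hm

variable [DecidableEq α]

theorem IsBase.notMem_spanOf_erase {J : Finset α} (hJ : IsBase v J) {m : α} (hm : m ∈ J) :
    v m ∉ spanOf v (J.erase m : Set α) := by
  have h := hJ.1
  rw [← Finset.insert_erase hm, Finset.coe_insert, linearIndepOn_insert (by simp)] at h
  exact h.2

theorem IsBase.exchange_iff {J : Finset α} (hJ : IsBase v J) {m j : α} (hm : m ∈ J)
    (hj : j ∉ J) : IsBase v (insert j (J.erase m)) ↔ v j ∉ spanOf v (J.erase m : Set α) := by
  have hj' : j ∉ J.erase m := fun h => hj (Finset.mem_of_mem_erase h)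
  rw [IsBase, Finset.coe_insert, linearIndepOn_insert (fun h => hj' (Finset.mem_coe.1 h)),
    Finset.card_insert_of_notMem hj', Finset.card_erase_add_one hm]
  exact ⟨fun h => h.1.2, fun h => ⟨⟨hJ.1.mono (by simp), h⟩, hJ.2⟩⟩

theorem IsBase.exchange_of_coord {J : Finset α} (hJ : IsBase v J) {m j : α} (hm : m ∈ J)
    (hj : j ∉ J) {φ : V →ₗ[ℝ] ℝ} (hφ : ∀ m' ∈ J, m' ≠ m → φ (v m') = 0) (h : φ (v j) ≠ 0) :
    IsBase v (insert j (J.erase m)) := by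
  rw [hJ.exchange_iff hm hj]
  intro hmem
  have : spanOf v (J.erase m : Set α) ≤ LinearMap.ker φ := by
    refine spanOf_le fun m' hm' => ?_
    simp only [Finset.coe_erase, Set.mem_sdiff, Finset.mem_coe, Set.mem_singleton_iff] at hm'
    exact hφ m' hm'.1 hm'.2
  exact h (this hmem)

theorem sum_exchange (w : α → ℝ) {J : Finset α} {m j : α} (hm : m ∈ J) (hj : j ∉ J) :
    ∑ i ∈ insert j (J.erase m), w i = ∑ i ∈ J, w i - w m + w j := by
  rw [Finset.sum_insert (fun h => hj (Finset.mem_of_mem_erase h)),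
    ← Finset.add_sum_erase J w hm]
  ring

variable {w : α → ℝ}

theorem IsMaxBase.le_of_exchange {J : Finset α} (hJ : IsMaxBase v w J) {m j : α} (hm : m ∈ J)
    (hj : j ∉ J) (h : IsBase v (insert j (J.erase m))) : w j ≤ w m := by
  have := hJ.2 _ h
  rw [sum_exchange w hm hj] at this
  linarith

theorem IsMaxBase.exchange {J : Finset α} (hJ : IsMaxBase v w J) {m j : α} (hm : m ∈ J)
    (hj : j ∉ J) (h : IsBase v (insert j (J.erase m))) (hw : w m = w j) :
    IsMaxBase v w (insert j (J.erase m)) := by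
  refine ⟨h, fun J' hJ' => (hJ.2 J' hJ').trans ?_⟩
  rw [sum_exchange w hm hj, hw]
  linarith

variable [FiniteDimensional ℝ V]

theorem IsBase.exists_coord {J : Finset α} (hJ : IsBase v J) :
    ∃ φ : α → V →ₗ[ℝ] ℝ, (∀ m ∈ J, φ m (v m) = 1) ∧
      (∀ m ∈ J, ∀ m' ∈ J, m' ≠ m → φ m (v m') = 0) ∧ ∀ x, x = ∑ m ∈ J, φ m x • v m := by
  have hli : LinearIndependent ℝ (fun x : J => v x) := hJ.1
  have hsp := hli.span_eq_top_of_card_eq_finrank' (by simpa using hJ.2)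
  set b := Basis.mk hli hsp.ge with hb
  have hbv : ∀ x : J, b x = v x := fun x => by simp [hb]
  -- The coordinate functionals of the basis `J`, extended by zero to indices outside `J`.
  refine ⟨fun m => if h : m ∈ J then b.coord ⟨m, h⟩ else 0, ?_, ?_, ?_⟩
  · intro m hm
    have := hbv ⟨m, hm⟩
    simp only at this
    simp [hm, ← this]
  · intro m hm m' hm' hne
    have := hbv ⟨m', hm'⟩
    simp only at this
    simp [hm, ← this, hne]
  · intro x
    conv_lhs => rw [← b.sum_repr x]
    rw [← Finset.sum_attach J]
    refine Finset.sum_congr rfl fun m _ => ?_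
    simp [hbv]

/-- A vector outside a basis is a combination of those basis vectors which it can replace. -/
theorem IsBase.mem_spanOf_exchangeable {J : Finset α} (hJ : IsBase v J) {j : α} (hj : j ∉ J) :
    v j ∈ spanOf v {m | m ∈ J ∧ IsBase v (insert j (J.erase m))} := by
  obtain ⟨φ, -, h0, hsum⟩ := hJ.exists_coord
  rw [hsum (v j)]
  refine Submodule.sum_mem _ fun m hm => ?_
  by_cases h : φ m (v j) = 0
  · simp [h]
  · exact Submodule.smul_mem _ _
      (mem_spanOf ⟨hm, hJ.exchange_of_coord hm hj (h0 m hm) h⟩)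

theorem IsBase.symm_exchange {J J' : Finset α} (hJ : IsBase v J) (hJ' : IsBase v J') {a : α}
    (ha : a ∈ J) (ha' : a ∉ J') : ∃ b ∈ J', b ∉ J ∧ IsBase v (insert b (J.erase a)) ∧
      IsBase v (insert a (J'.erase b)) := by
  obtain ⟨φ, h1, h0, -⟩ := hJ.exists_coord
  obtain ⟨ψ, -, k0, ksum⟩ := hJ'.exists_coord
  -- Expanding `v a` in the basis `J'` and taking its `a`-coordinate in `J` gives `1`; any nonzero
  -- term of the sum permits both exchanges with the same `b`.
  have hne : ∑ b ∈ J', ψ b (v a) * φ a (v b) ≠ 0 := by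
    have := congrArg (φ a) (ksum (v a))
    rw [h1 a ha, map_sum] at this
    simp only [map_smul, smul_eq_mul] at this
    rw [← this]
    exact one_ne_zero
  obtain ⟨b, hb, hb'⟩ := Finset.exists_ne_zero_of_sum_ne_zero hne
  have hbJ : b ∉ J := fun h => right_ne_zero_of_mul hb'
    (h0 a ha b h (fun e => ha' (e ▸ hb)))
  exact ⟨b, hb, hbJ, hJ.exchange_of_coord ha hbJ (h0 a ha) (right_ne_zero_of_mul hb'),
    hJ'.exchange_of_coord hb ha' (k0 b hb) (left_ne_zero_of_mul hb')⟩

/-- By optimality, an outside vector can replace only basis vectors of at least its own weight, and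
it is a combination of the vectors it can replace. -/
theorem IsMaxBase.mem_spanOf_ge {J : Finset α} (hJ : IsMaxBase v w J) (j : α) :
    v j ∈ spanOf v {m | m ∈ J ∧ w j ≤ w m} := by
  by_cases hj : j ∈ J
  · exact mem_spanOf ⟨hj, le_rfl⟩
  · refine spanOf_mono ?_ (hJ.1.mem_spanOf_exchangeable hj)
    exact fun m hm => ⟨hm.1, hJ.le_of_exchange hm.1 hj hm.2⟩

theorem IsMaxBase.spanOf_gt_le {J : Finset α} (hJ : IsMaxBase v w J) (t : ℝ) :
    spanOf v {m | t < w m} ≤ spanOf v {m | m ∈ J ∧ t < w m} :=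
  spanOf_le fun m hm => by
    refine spanOf_mono ?_ (hJ.mem_spanOf_ge m)
    exact fun _ h => ⟨h.1, lt_of_lt_of_le hm h.2⟩

/-- Two maximal bases differ by one exchange of elements of equal weight, provided that there is
at most one pair of elements of equal weight (a condition that is void in rank one). -/
theorem IsMaxBase.eq_exchange {J J' : Finset α} (hJ : IsMaxBase v w J) (hJ' : IsMaxBase v w J')
    (hne : J ≠ J') (hpair : 2 ≤ finrank ℝ V → ∀ a b a' b', a ≠ b → a' ≠ b' → w a = w b →
      w a' = w b' → a = a' ∨ a = b') :
    ∃ a ∈ J, ∃ b, b ∉ J ∧ w a = w b ∧ J' = insert b (J.erase a) := by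
  have hcard : J.card = J'.card := hJ.1.2.trans hJ'.1.2.symm
  have key : ∀ a ∈ J, a ∉ J' → ∃ b ∈ J', b ∉ J ∧ w a = w b := by
    intro a ha ha'
    obtain ⟨b, hb, hb', h1, h2⟩ := hJ.1.symm_exchange hJ'.1 ha ha'
    exact ⟨b, hb, hb', le_antisymm (hJ'.le_of_exchange hb ha' h2) (hJ.le_of_exchange ha hb' h1)⟩
  have hnot : ¬ J ⊆ J' := fun h => hne (Finset.eq_of_subset_of_card_le h hcard.ge)
  obtain ⟨a, ha, ha'⟩ := Finset.not_subset.1 hnot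
  obtain ⟨b, hb, hb', hab⟩ := key a ha ha'
  refine ⟨a, ha, b, hb', hab, ?_⟩
  -- A second element of `J` missing from `J'` would give another pair of equal weights, which
  -- `hpair` excludes. Two such elements exist only in rank at least two.
  have hsub : J.erase a ⊆ J' := by
    intro a₁ h₁
    obtain ⟨hne₁, h₁⟩ := Finset.mem_erase.1 h₁
    by_contra h₁'
    obtain ⟨b₁, hb₁, hb₁', hab₁⟩ := key a₁ h₁ h₁'
    have h2 : 2 ≤ finrank ℝ V := by
      rw [← hJ.1.2]
      exact Finset.one_lt_card.2 ⟨a, ha, a₁, h₁, hne₁.symm⟩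
    rcases hpair h2 a b a₁ b₁ (fun e => hb' (e ▸ ha)) (fun e => hb₁' (e ▸ h₁)) hab hab₁ with e | e
    · exact hne₁ e.symm
    · exact hb₁' (e ▸ ha)
  refine (Finset.eq_of_subset_of_card_le (Finset.insert_subset hb hsub) ?_).symm
  rw [Finset.card_insert_of_notMem (fun h => hb' (Finset.mem_of_mem_erase h)),
    Finset.card_erase_add_one ha, hcard]

theorem IsMaxBase.eq_or_eq {J J' J'' : Finset α} (hJ : IsMaxBase v w J)
    (hJ' : IsMaxBase v w J') (hJ'' : IsMaxBase v w J'') (hne : J ≠ J')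
    (hpair : 2 ≤ finrank ℝ V → ∀ a b a' b', a ≠ b → a' ≠ b' → w a = w b →
      w a' = w b' → a = a' ∨ a = b')
    (hcls : ∀ a b m, a ≠ b → w a = w b → w m = w a → m = a ∨ m = b) : J'' = J ∨ J'' = J' := by
  by_cases h : J = J''
  · exact Or.inl h.symm
  obtain ⟨a, ha, b, hb, hab, e⟩ := hJ.eq_exchange hJ' hne hpair
  obtain ⟨a', ha', b', hb', hab', e'⟩ := hJ.eq_exchange hJ'' h hpair
  have hne₁ : a ≠ b := fun e => hb (e ▸ ha)
  have hne₂ : a' ≠ b' := fun e => hb' (e ▸ ha')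
  have haa : a = a' := by
    by_contra hne
    have h2 : 2 ≤ finrank ℝ V := by
      rw [← hJ.1.2]
      exact Finset.one_lt_card.2 ⟨a, ha, a', ha', hne⟩
    rcases hpair h2 a b a' b' hne₁ hne₂ hab hab' with e | e
    · exact hne e
    · exact hb' (e ▸ ha)
  subst haa
  rcases hcls a b b' hne₁ hab hab'.symm with h | h
  · exact absurd h.symm hne₂
  · exact Or.inr (by rw [e, e', h])

/-- The heavier vectors are spanned by heavier members of `J`, hence without `a`, while the exchange
needs `v b` outside the span of `J.erase a`. In the expansion of `v b` over members of at least its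
weight, `a` is the only one of equal weight. -/
theorem IsMaxBase.span_of_exchange {J : Finset α} (hJ : IsMaxBase v w J) {a b : α} (ha : a ∈ J)
    (hb : b ∉ J) (hab : w a = w b) (hJ' : IsBase v (insert b (J.erase a)))
    (hcls : ∀ m, w m = w a → m = a ∨ m = b) :
    v b ∉ spanOf v {m | w a < w m} ∧ v b ∈ spanOf v (insert a {m | w a < w m}) := by
  constructor
  · intro h
    refine (hJ.1.exchange_iff ha hb).1 hJ' (spanOf_mono ?_ (hJ.spanOf_gt_le _ h))
    rintro m ⟨hm, hlt⟩
    simp only [Finset.coe_erase, Set.mem_sdiff, Finset.mem_coe, Set.mem_singleton_iff]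
    exact ⟨hm, fun e => hlt.ne (by rw [e])⟩
  · refine spanOf_mono ?_ (hJ.mem_spanOf_ge b)
    rintro m ⟨hm, hle⟩
    rcases hle.eq_or_lt with e | hlt
    · rcases hcls m (by rw [← e, hab]) with h | h
      · exact Or.inl h
      · exact absurd hm (h ▸ hb)
    · exact Or.inr (by simpa [hab] using hlt)

/-- Converse to `IsMaxBase.span_of_exchange`. If both indices were in `J`, then `h2` would
contradict independence; if at most one is in `J` and the swap were impossible, the expansion of the
outside vector would use only heavier vectors, contradicting `h1`. -/
theorem IsMaxBase.exists_tie {J : Finset α} (hJ : IsMaxBase v w J) {i j : α}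
    (hij : i ≠ j) (hw : w j = w i) (hcls : ∀ m, w m = w j → m = i ∨ m = j)
    (h1 : v i ∉ spanOf v {m | w j < w m}) (h2 : v i ∈ spanOf v (insert j {m | w j < w m})) :
    ∃ x ∈ J, ∃ y, y ∉ J ∧ (x = i ∧ y = j ∨ x = j ∧ y = i) ∧
      IsMaxBase v w (insert y (J.erase x)) := by
  by_cases hi : i ∈ J
  · by_cases hj : j ∈ J
    · exfalso
      refine hJ.1.notMem_spanOf_erase hi ?_
      refine (spanOf_le ?_ : spanOf v (insert j {m | w j < w m}) ≤ _) h2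
      rintro m (rfl | hm)
      · exact mem_spanOf (by simp [hj, hij.symm])
      · refine spanOf_mono ?_ (hJ.spanOf_gt_le (w j) (mem_spanOf hm))
        rintro m' ⟨hm', hlt⟩
        simp only [Finset.coe_erase, Set.mem_sdiff, Finset.mem_coe, Set.mem_singleton_iff]
        exact ⟨hm', fun e => hlt.ne (by rw [e, hw])⟩
    · have hex : IsBase v (insert j (J.erase i)) := by
        by_contra hcon
        have hjs : v j ∈ spanOf v {m | w j < w m} := by
          refine spanOf_mono ?_ (hJ.1.mem_spanOf_exchangeable hj)
          rintro m ⟨hm, hm'⟩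
          refine lt_of_le_of_ne (hJ.le_of_exchange hm hj hm') fun e => ?_
          rcases hcls m e.symm with rfl | rfl
          · exact hcon hm'
          · exact hj hm
        refine h1 ((spanOf_le ?_ : spanOf v (insert j {m | w j < w m}) ≤ _) h2)
        rintro m (rfl | hm)
        · exact hjs
        · exact mem_spanOf hm
      exact ⟨i, hi, j, hj, Or.inl ⟨rfl, rfl⟩, hJ.exchange hi hj hex hw.symm⟩
  · have hex : j ∈ J ∧ IsBase v (insert i (J.erase j)) := by
      by_contra hcon
      refine h1 (spanOf_mono ?_ (hJ.1.mem_spanOf_exchangeable hi))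
      rintro m ⟨hm, hm'⟩
      refine lt_of_le_of_ne (hw.trans_le (hJ.le_of_exchange hm hi hm')) fun e => ?_
      rcases hcls m e.symm with rfl | rfl
      · exact hi hm
      · exact hcon ⟨hm, hm'⟩
    exact ⟨j, hex.1, i, hi, Or.inr ⟨rfl, rfl⟩, hJ.exchange hex.1 hi hex.2 hw⟩

end LinearMatroid

/-! ### The Grassmann necklace and its permutation in terms of spans. -/

section Necklace

variable {k n : ℕ}

/-- The elements strictly between `i` and `j` in the cyclic order starting at `i`. -/
def between (i j : Fin n) : Set (Fin n) := {m | m ≠ i ∧ cyclicRank i m < cyclicRank i j}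

theorem cyclicRank_of_le {r j : Fin n} (h : r ≤ j) : cyclicRank r j = j.val - r.val := by
  have h' : r.val ≤ j.val := h
  have := j.isLt
  rw [cyclicRank, show j.val + n - r.val = (j.val - r.val) + n by omega, Nat.add_mod_right,
    Nat.mod_eq_of_lt (by omega)]

theorem cyclicRank_of_lt {r j : Fin n} (h : j < r) : cyclicRank r j = j.val + n - r.val := by
  have h' : j.val < r.val := h
  have := r.isLt
  rw [cyclicRank, Nat.mod_eq_of_lt (by omega)]

theorem cyclicRank_injective (r : Fin n) : Function.Injective (cyclicRank r) := by
  intro i j h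
  have := i.isLt
  have := j.isLt
  have := r.isLt
  rcases le_or_gt r i with hi | hi <;> rcases le_or_gt r j with hj | hj <;>
    simp only [cyclicRank_of_le, cyclicRank_of_lt, hi, hj] at h <;>
    simp only [Fin.le_def, Fin.lt_def] at hi hj <;> ext <;> omega

theorem cyclicRank_self (r : Fin n) : cyclicRank r r = 0 := by
  rw [cyclicRank_of_le le_rfl]; omega

theorem cyclicRank_finRotate {r m : Fin n} (h : m ≠ r) :
    cyclicRank (finRotate n r) m + 1 = cyclicRank r m := by
  obtain ⟨n, rfl⟩ : ∃ n', n = n' + 1 := ⟨n - 1, by have := r.isLt; omega⟩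
  have hm := m.isLt
  have hr := r.isLt
  have hne : m.val ≠ r.val := fun e => h (Fin.ext e)
  have hval : (finRotate (n + 1) r).val = if r.val = n then 0 else r.val + 1 := by
    rw [finRotate_apply, Fin.val_add_one]
    simp [Fin.ext_iff]
  have hcases : ∀ r : Fin (n + 1), cyclicRank r m =
      if r.val ≤ m.val then m.val - r.val else m.val + (n + 1) - r.val := by
    intro r
    split_ifs with hle
    · exact cyclicRank_of_le hle
    · exact cyclicRank_of_lt (not_le.1 hle)
  rw [hcases, hcases, hval]
  split_ifs <;> omega

/-- One cubic sign condition covers both shapes of the cyclic interval: the interior for `i < j`,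
and the complement of `[j, i]` for `j < i`. It is later matched with a difference of weights. -/
theorem mem_between_iff {κ : Fin n → ℝ} (hκ : StrictMono κ) {i j m : Fin n} (hij : i ≠ j) :
    m ∈ between i j ↔ 0 < (κ i - κ j) * ((κ m - κ j) * (κ m - κ i)) := by
  have hi := i.isLt
  have hj := j.isLt
  have hm := m.isLt
  rw [between, Set.mem_ofPred_eq]
  rcases lt_or_gt_of_ne hij with h | h
  · have e : m ≠ i ∧ cyclicRank i m < cyclicRank i j ↔ i < m ∧ m < j := by
      rw [cyclicRank_of_le h.le]
      rcases le_or_gt i m with h' | h'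
      · rw [cyclicRank_of_le h']
        simp only [Fin.le_def, Fin.lt_def, ne_eq, Fin.ext_iff] at *
        omega
      · rw [cyclicRank_of_lt h']
        simp only [Fin.lt_def, ne_eq, Fin.ext_iff] at *
        omega
    rw [e, ← neg_mul_neg, mul_pos_iff_of_pos_left (neg_pos.2 (sub_neg.2 (hκ h))), neg_pos, mul_neg_iff]
    simp only [sub_pos, sub_neg, hκ.lt_iff_lt]
    constructor
    · rintro ⟨h1, h2⟩; exact Or.inr ⟨h2, h1⟩
    · rintro (⟨h1, h2⟩ | ⟨h1, h2⟩)
      · exact absurd (h1.trans h2) (not_lt.2 h.le)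
      · exact ⟨h2, h1⟩
  · have e : m ≠ i ∧ cyclicRank i m < cyclicRank i j ↔ i < m ∨ m < j := by
      rw [cyclicRank_of_lt h]
      rcases le_or_gt i m with h' | h'
      · rw [cyclicRank_of_le h']
        simp only [Fin.le_def, Fin.lt_def, ne_eq, Fin.ext_iff] at *
        omega
      · rw [cyclicRank_of_lt h']
        simp only [Fin.lt_def, ne_eq, Fin.ext_iff] at *
        omega
    rw [e, mul_pos_iff_of_pos_left (sub_pos.2 (hκ h)), mul_pos_iff]
    simp only [sub_pos, sub_neg, hκ.lt_iff_lt]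
    constructor
    · rintro (h1 | h1)
      · exact Or.inl ⟨h.trans h1, h1⟩
      · exact Or.inr ⟨h1, h1.trans h⟩
    · rintro (⟨h1, h2⟩ | ⟨h1, h2⟩)
      · exact Or.inl h2
      · exact Or.inr h1

variable {V : Type*} [AddCommGroup V] [Module ℝ V] [FiniteDimensional ℝ V] {v : Fin n → V}
  {I : Fin n → Finset (Fin n)} {π : Equiv.Perm (Fin n)}

theorem rank_lt_of_lexLE_exchange {r : Fin n} {J : Finset (Fin n)} {m j : Fin n}
    (hj : j ∉ J) (h : LexLE r J (insert j (J.erase m))) : cyclicRank r m < cyclicRank r j := by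
  rcases h with h | ⟨a, ha, hb⟩
  · exact absurd (h ▸ Finset.mem_insert_self j _) hj
  · simp only [Finset.mem_sdiff, Finset.mem_insert, Finset.mem_erase, not_or, not_and] at ha
    obtain ⟨h1, h2, h3⟩ := ha
    obtain rfl : a = m := by
      by_contra hne
      exact h3 hne h1
    exact hb j (by simp [hj])

theorem mem_spanOf_necklace (hI : IsNecklaceOf {J | IsBase v J} I) (r j : Fin n) :
    v j ∈ spanOf v {m | m ∈ I r ∧ cyclicRank r m ≤ cyclicRank r j} := by
  by_cases hj : j ∈ I r
  · exact mem_spanOf ⟨hj, le_rfl⟩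
  · refine spanOf_mono ?_ (IsBase.mem_spanOf_exchangeable (hI r).1 hj)
    rintro m ⟨hm, hm'⟩
    exact ⟨hm, (rank_lt_of_lexLE_exchange hj ((hI r).2 _ hm')).le⟩

/-- Write `i = π j` and let `r` follow `i` cyclically. Minimality of `I r` puts the vectors of
`between i j` in the span of members of `I r` preceding `j`; since `I i` is a basis, `v i` is not in
the span of `I r` without `j`. Conversely, `v i` is a combination of members `m` of `I r` it can
replace, and minimality of `I i` makes each such `m ≠ j` precede `j`. -/
theorem perm_spec (hI : IsNecklaceOf {J | IsBase v J} I) (hπ : IsPermOfNecklace I π) (j : Fin n) :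
    π j ≠ j ∧ v (π j) ∉ spanOf v (between (π j) j) ∧
      v (π j) ∈ spanOf v (insert j (between (π j) j)) := by
  have hbase : ∀ r, IsBase v (I r) := fun r => (hI r).1
  have hex : ∀ j, j ≠ π j ∧ I (finRotate n (π j)) = insert j (I (π j) \ {π j}) := by
    intro j
    obtain ⟨j', h1, h2, h3⟩ := hπ (π j)
    obtain rfl := π.injective h3
    exact ⟨h1, h2⟩
  -- every vector belongs to some basis, hence is non-zero
  have hne0 : ∀ m, v m ≠ 0 := by
    intro m
    have h := (hbase (finRotate n (π m))).1
    refine h.ne_zero ?_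
    rw [(hex m).2]; simp
  obtain ⟨hji, hstep⟩ := hex j
  generalize π j = i at hji hstep ⊢
  -- Otherwise greediness at the first index `i` would put `v i` in the span of no vectors, although
  -- it is nonzero.
  have hii : i ∈ I i := by
    by_contra h
    have := mem_spanOf_necklace hI i i
    rw [cyclicRank_self] at this
    have hempty : {m | m ∈ I i ∧ cyclicRank i m ≤ 0} = ∅ := by
      ext m
      simp only [Set.mem_ofPred_eq, Set.mem_empty_iff_false, iff_false, not_and]
      intro hm hr
      rw [← cyclicRank_self i] at hr
      have : m = i := by
        refine cyclicRank_injective i (le_antisymm hr ?_)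
        rw [cyclicRank_self]; exact Nat.zero_le _
      exact h (this ▸ hm)
    rw [hempty] at this
    rw [spanOf, Set.image_empty, Submodule.span_empty, Submodule.mem_bot] at this
    exact hne0 i this
  rw [← Finset.erase_eq] at hstep
  set r := finRotate n i with hr
  have hcard : (I r).card = (I i).card := (hbase r).2.trans (hbase i).2.symm
  have hjI : j ∉ I i := by
    intro h
    rw [hstep, Finset.insert_eq_of_mem (Finset.mem_erase.2 ⟨hji, h⟩)] at hcard
    have := Finset.card_erase_add_one hii
    omega
  have hir : i ∉ I r := by
    rw [hstep]; simp [hji.symm]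
  have hjr : j ∈ I r := by rw [hstep]; simp
  have hIi : I i = insert i ((I r).erase j) := by
    rw [hstep, Finset.erase_insert (by simp [hjI]), Finset.insert_erase hii]
  refine ⟨hji.symm, ?_, ?_⟩
  · intro hmem
    refine ((hbase r).exchange_iff hjr hir).1 (hIi ▸ hbase i) ?_
    refine (spanOf_le ?_ : spanOf v (between i j) ≤ _) hmem
    rintro m ⟨hmi, hlt⟩
    refine spanOf_mono ?_ (mem_spanOf_necklace hI r m)
    rintro m' ⟨hm', hle⟩
    simp only [Finset.coe_erase, Set.mem_sdiff, Finset.mem_coe, Set.mem_singleton_iff]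
    refine ⟨hm', ?_⟩
    rintro rfl
    have h1 := cyclicRank_finRotate hmi
    have h2 := cyclicRank_finRotate hji
    rw [← hr] at h1 h2
    omega
  · refine spanOf_mono ?_ ((hbase r).mem_spanOf_exchangeable hir)
    rintro m ⟨hm, hm'⟩
    by_cases hmj : m = j
    · exact Or.inl hmj
    · have hmI : m ∈ I i := by
        rw [hIi]; simp [hm, hmj]
      have hmi : m ≠ i := fun e => hir (e ▸ hm)
      refine Or.inr ⟨hmi, rank_lt_of_lexLE_exchange hjI ?_⟩
      -- The exchange in `I r` is rewritten as an exchange in `I i`, where minimality for the order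
      -- starting at `i` applies.
      have e : insert i ((I r).erase m) = insert j ((I i).erase m) := by
        rw [hIi]
        ext z
        simp only [Finset.mem_insert, Finset.mem_erase]
        by_cases hz : z = j
        · subst hz; simp [hjr, Ne.symm hmj]
        · by_cases hz' : z = i
          · subst hz'; simp [Ne.symm hmi]
          · simp [hz, hz']
      rw [← e]
      exact (hI i).2 _ hm'

/-- The intervals starting after `i` are nested, so there is only one index `j` at which `v i` first
enters the span. -/
theorem perm_eq_of_span (hI : IsNecklaceOf {J | IsBase v J} I) (hπ : IsPermOfNecklace I π)
    {i j : Fin n} (hij : i ≠ j) (h1 : v i ∉ spanOf v (between i j))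
    (h2 : v i ∈ spanOf v (insert j (between i j))) : π j = i := by
  obtain ⟨j', rfl⟩ := π.surjective i
  obtain ⟨h0, h3, h4⟩ := perm_spec hI hπ j'
  have key : ∀ {a b : Fin n}, cyclicRank (π j') a < cyclicRank (π j') b → a ≠ π j' →
      insert a (between (π j') a) ⊆ between (π j') b := by
    rintro a b hlt ha m (rfl | hm)
    · exact ⟨ha, hlt⟩
    · exact ⟨hm.1, hm.2.trans hlt⟩
  rcases lt_trichotomy (cyclicRank (π j') j') (cyclicRank (π j') j) with h | h | h
  · exact absurd (spanOf_mono (key h h0.symm) h4) h1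
  · rw [cyclicRank_injective _ h]
  · exact absurd (spanOf_mono (key h hij.symm) h2) h3

end Necklace

/-! ### Cones inside extreme cells, boundedness, and enumeration by a real key. -/

section Unbounded

variable {ι : Type*} {s q c : ι → ℝ}

/-- The sign `σ` treats the leftmost (`σ = 1`) and rightmost (`σ = -1`) cells together. A strictly
extreme slope beats the `y` and constant terms once `|x|` exceeds a fixed multiple of `1 + |y|`. -/
theorem exists_cone_subset_cell [Finite ι] {i : ι} {σ : ℝ} (hσ : σ * σ = 1)
    (hi : ∀ j, j ≠ i → 0 < σ * (s j - s i)) :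
    ∃ C : ℝ, ∀ x y : ℝ, σ * x < -C * (1 + |y|) → (x, y) ∈ cell s q c i := by
  obtain ⟨C, hC⟩ := (Set.finite_range fun j =>
    (|q j - q i| + |c j - c i|) / (σ * (s j - s i))).bddAbove
  refine ⟨C, fun x y hxy j hj => ?_⟩
  have h1 : (|q j - q i| + |c j - c i|) / (σ * (s j - s i)) ≤ C := hC ⟨j, rfl⟩
  have hpos := hi j hj
  rw [div_le_iff₀ hpos] at h1
  have h2 := mul_lt_mul_of_pos_left hxy hpos
  have h3 : (|q j - q i| + |c j - c i|) * (1 + |y|) ≤ C * (σ * (s j - s i)) * (1 + |y|) :=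
    mul_le_mul_of_nonneg_right h1 (by positivity)
  have h4 : (q j - q i) * y ≤ |q j - q i| * |y| := by
    rw [← abs_mul]; exact le_abs_self _
  have h5 := le_abs_self (c j - c i)
  have h6 : σ * (s j - s i) * (σ * x) = (s j - s i) * x := by
    linear_combination ((s j - s i) * x) * hσ
  have h7 : 0 ≤ |q j - q i| := abs_nonneg _
  have h8 : 0 ≤ |c j - c i| * |y| := by positivity
  simp only [plane]
  nlinarith

theorem exists_abs_snd_le {S : Set (ℝ × ℝ)} (h1 : ¬ ExtendsAlong atTop S)
    (h2 : ¬ ExtendsAlong atBot S) : ∃ B, ∀ p ∈ S, |p.2| ≤ B := by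
  simp only [ExtendsAlong, not_frequently, not_exists] at h1 h2
  obtain ⟨b₁, hb₁⟩ := eventually_atTop.1 h1
  obtain ⟨b₂, hb₂⟩ := eventually_atBot.1 h2
  refine ⟨max b₁ (-b₂), fun p hp => abs_le'.2 ⟨?_, ?_⟩⟩
  · exact le_max_of_le_left (le_of_not_ge fun h => hb₁ _ h p.1 hp)
  · exact le_max_of_le_right (neg_le_neg (le_of_not_ge fun h => hb₂ _ h p.1 hp))

theorem isBounded_of_abs_le {S : Set (ℝ × ℝ)} {D B : ℝ} (h1 : ∀ p ∈ S, |p.1| ≤ D)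
    (h2 : ∀ p ∈ S, |p.2| ≤ B) : Bornology.IsBounded S := by
  refine (Metric.isBounded_closedBall (x := (0 : ℝ × ℝ)) (r := max D B)).subset fun p hp => ?_
  rw [mem_closedBall_zero_iff, Prod.norm_def]
  exact max_le_max (h1 p hp) (h2 p hp)

theorem exists_abs_fst_le {i j : ι} (hij : s i ≠ s j) {B : ℝ} :
    ∃ D, ∀ p ∈ closedCell s q c i ∩ closedCell s q c j, |p.2| ≤ B → |p.1| ≤ D := by
  refine ⟨(|q i - q j| * B + |c i - c j|) / |s i - s j|, fun p hp hB => ?_⟩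
  have hpos : 0 < |s i - s j| := abs_pos.2 (sub_ne_zero.2 hij)
  have heq := le_antisymm (hp.2 i) (hp.1 j)
  simp only [plane] at heq
  rw [le_div_iff₀ hpos, ← abs_mul]
  have : p.1 * (s i - s j) = -((q i - q j) * p.2 + (c i - c j)) := by linarith
  rw [this, abs_neg]
  refine (abs_add_le _ _).trans ?_
  rw [abs_mul]
  gcongr

theorem exists_strictMono_enum {α : Type*} (E : Finset α) {f : α → ℝ} (hf : Set.InjOn f E) :
    ∃ e : Fin E.card → α, Set.range e = E ∧ StrictMono fun m => f (e m) := by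
  classical
  have hcard : (E.image f).card = E.card := Finset.card_image_of_injOn hf
  have hmem : ∀ m, ∃ x ∈ E, f x = (E.image f).orderEmbOfFin hcard m := fun m =>
    Finset.mem_image.1 (Finset.orderEmbOfFin_mem _ hcard m)
  choose e he hfe using hmem
  refine ⟨e, ?_, fun m m' h => ?_⟩
  · ext x
    constructor
    · rintro ⟨m, rfl⟩; exact he m
    · intro hx
      have : f x ∈ Set.range ((E.image f).orderEmbOfFin hcard) := by
        rw [Finset.range_orderEmbOfFin]
        exact Finset.mem_coe.2 (Finset.mem_image_of_mem f hx)
      obtain ⟨m, hm⟩ := this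
      exact ⟨m, hf (he m) hx ((hfe m).trans hm)⟩
  · simp only [hfe]
    exact ((E.image f).orderEmbOfFin hcard).strictMono h

end Unbounded

/-! ### Positive minors as column bases. -/

section Minors

variable {k n : ℕ}

theorem minor_ne_zero_iff (A : Matrix (Fin k) (Fin n) ℝ) (J : Finset (Fin n)) :
    minor A J ≠ 0 ↔ IsBase A.col J := by
  rw [IsBase, Module.finrank_fin_fun]
  unfold minor
  split_ifs with h
  · rw [← isUnit_iff_ne_zero, ← Matrix.isUnit_iff_isUnit_det,
      ← Matrix.linearIndependent_cols_iff_isUnit, and_iff_left h, LinearIndepOn,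
      ← linearIndependent_equiv (J.orderIsoOfFin h).toEquiv]
    rfl
  · simp [h]

theorem minor_pos_iff {M : Set (Finset (Fin n))} {A : Matrix (Fin k) (Fin n) ℝ}
    (hA : A ∈ positroidCell k M) (J : Finset (Fin n)) : 0 < minor A J ↔ IsBase A.col J := by
  rw [← minor_ne_zero_iff]
  refine ⟨fun h => h.ne', fun h => hA.2.1 J ?_⟩
  by_contra hJ
  exact h (hA.2.2 J hJ)

theorem eq_setOf_isBase {M : Set (Finset (Fin n))} {A : Matrix (Fin k) (Fin n) ℝ}
    (hA : A ∈ positroidCell k M) : M = {J | IsBase A.col J} := by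
  ext J
  rw [Set.mem_ofPred_eq, ← minor_pos_iff hA]
  refine ⟨hA.2.1 J, fun h => ?_⟩
  by_contra hJ
  exact h.ne' (hA.2.2 J hJ)

theorem minor_nonneg {M : Set (Finset (Fin n))} {A : Matrix (Fin k) (Fin n) ℝ}
    (hA : A ∈ positroidCell k M) (J : Finset (Fin n)) : 0 ≤ minor A J := by
  by_cases hJ : J ∈ M
  · exact (hA.2.1 J hJ).le
  · exact (hA.2.2 J hJ).ge

theorem nonempty_pos_minor {M : Set (Finset (Fin n))} {A : Matrix (Fin k) (Fin n) ℝ}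
    (hA : A ∈ positroidCell k M) {I : Fin n → Finset (Fin n)} (hI : IsNecklaceOf M I) :
    Nonempty {J : Finset (Fin n) // 0 < minor A J} := by
  -- For `n = 0` the necklace has no entry to supply a basis, and the empty set serves.
  rcases Nat.eq_zero_or_pos n with rfl | hn
  · have hk : k = 0 := by
      have := A.rank_le_width
      rw [hA.1] at this
      omega
    subst hk
    exact ⟨∅, (minor_pos_iff hA _).2 ⟨by simp, by simp⟩⟩
  · exact ⟨I ⟨0, hn⟩, hA.2.1 _ (hI _).1⟩

end Minors

/-! ### Regions and line-solitons of the contour plot as cells. -/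

section Contour

variable {k n : ℕ} {κ : Fin n → ℝ} {A : Matrix (Fin k) (Fin n) ℝ} {t : ℝ}

/-- The `x`-slope of the phase of `E_J`. -/
noncomputable def slopeX (κ : Fin n → ℝ) (A : Matrix (Fin k) (Fin n) ℝ)
    (J : {J : Finset (Fin n) // 0 < minor A J}) : ℝ := ∑ j ∈ J.1, κ j

/-- The `y`-slope of the phase of `E_J`. -/
noncomputable def slopeY (κ : Fin n → ℝ) (A : Matrix (Fin k) (Fin n) ℝ)
    (J : {J : Finset (Fin n) // 0 < minor A J}) : ℝ := ∑ j ∈ J.1, κ j ^ 2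

/-- The constant term of the phase of `Δ_J(A) E_J` at time `t`. -/
noncomputable def offset (κ : Fin n → ℝ) (A : Matrix (Fin k) (Fin n) ℝ) (t : ℝ)
    (J : {J : Finset (Fin n) // 0 < minor A J}) : ℝ :=
  Real.log (minor A J.1 * vandermondeFactor κ J.1) + ∑ j ∈ J.1, κ j ^ 3 * t

/-- The region in which `E_J` is the only dominant exponential. -/
abbrev region (κ : Fin n → ℝ) (A : Matrix (Fin k) (Fin n) ℝ) (t : ℝ)
    (J : {J : Finset (Fin n) // 0 < minor A J}) : Set (ℝ × ℝ) :=
  cell (slopeX κ A) (slopeY κ A) (offset κ A t) J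

/-- The set on which `E_J` is a dominant exponential. -/
abbrev closedRegion (κ : Fin n → ℝ) (A : Matrix (Fin k) (Fin n) ℝ) (t : ℝ)
    (J : {J : Finset (Fin n) // 0 < minor A J}) : Set (ℝ × ℝ) :=
  closedCell (slopeX κ A) (slopeY κ A) (offset κ A t) J

theorem plane_eq (J : {J : Finset (Fin n) // 0 < minor A J}) (p : ℝ × ℝ) :
    plane (slopeX κ A) (slopeY κ A) (offset κ A t) J p =
      Real.log (minor A J.1 * vandermondeFactor κ J.1) + ∑ j ∈ J.1, phase κ t j p := by
  simp only [plane, slopeX, slopeY, offset, phase, Finset.sum_add_distrib, Finset.sum_mul]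
  ring

theorem contourPlot_eq : contourPlot κ A t =
    kinks fun p => ⨆ J, plane (slopeX κ A) (slopeY κ A) (offset κ A t) J p := by
  simp only [plane_eq]
  rfl

theorem vandermondeFactor_pos (hκ : StrictMono κ) (J : Finset (Fin n)) :
    0 < vandermondeFactor κ J :=
  Finset.prod_pos fun _ _ => Finset.prod_pos fun _ hm =>
    sub_pos.2 (hκ (Finset.mem_filter.1 hm).2)

theorem minor_mul_expE (hκ : StrictMono κ) (J : {J : Finset (Fin n) // 0 < minor A J})
    (p : ℝ × ℝ) : minor A J.1 * expE κ t J.1 p =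
      Real.exp (plane (slopeX κ A) (slopeY κ A) (offset κ A t) J p) := by
  rw [plane_eq, Real.exp_add, Real.exp_log (mul_pos J.2 (vandermondeFactor_pos hκ _)),
    Real.exp_sum, expE, mul_assoc]

theorem isDominantOn_region_iff (hκ : StrictMono κ) (hA : ∀ J, 0 ≤ minor A J)
    {J : {J : Finset (Fin n) // 0 < minor A J}} (hJ : (region κ A t J).Nonempty)
    (I : Finset (Fin n)) : IsDominantOn κ A t (region κ A t J) I ↔ I = J.1 := by
  constructor
  · rintro ⟨hI, h⟩
    obtain ⟨p, hp⟩ := hJ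
    have h1 := h p hp J.1
    rw [minor_mul_expE hκ J, minor_mul_expE hκ ⟨I, hI⟩, Real.exp_le_exp] at h1
    by_contra hne
    exact absurd h1 (not_le.2 (hp ⟨I, hI⟩ fun e => hne (congrArg Subtype.val e)))
  · rintro rfl
    refine ⟨J.2, fun p hp I => ?_⟩
    rcases (hA I).eq_or_lt with h | h
    · rw [← h, zero_mul, minor_mul_expE hκ J]
      positivity
    · rw [minor_mul_expE hκ J, minor_mul_expE hκ ⟨I, h⟩, Real.exp_le_exp]
      exact cell_subset_closedCell J hp ⟨I, h⟩

theorem isRegion_iff [Nonempty {J : Finset (Fin n) // 0 < minor A J}]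
    (hs : Function.Injective (slopeX κ A)) {R : Set (ℝ × ℝ)} :
    IsRegion κ A t R ↔ ∃ J, (region κ A t J).Nonempty ∧ R = region κ A t J := by
  rw [IsRegion, contourPlot_eq, compl_kinks hs]
  constructor
  · rintro ⟨p, hp, rfl⟩
    obtain ⟨J, hJ⟩ := Set.mem_iUnion.1 hp
    exact ⟨J, ⟨p, hJ⟩, connectedComponentIn_cell hJ⟩
  · rintro ⟨J, ⟨p, hp⟩, rfl⟩
    exact ⟨p, Set.mem_iUnion.2 ⟨J, hp⟩, (connectedComponentIn_cell hp).symm⟩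

theorem region_injective {J J' : {J : Finset (Fin n) // 0 < minor A J}}
    (hJ : (region κ A t J).Nonempty) (h : region κ A t J = region κ A t J') : J = J' := by
  obtain ⟨p, hp⟩ := hJ
  exact (eq_of_mem_cell_of_mem_closedCell hp (cell_subset_closedCell J'
    (show p ∈ region κ A t J' from h ▸ hp))).symm

theorem exists_of_isLineSoliton [Nonempty {J : Finset (Fin n) // 0 < minor A J}]
    (hs : Function.Injective (slopeX κ A)) {L : Set (ℝ × ℝ)}
    (hL : IsLineSoliton κ A t L) :
    ∃ J J', J ≠ J' ∧ L = closedRegion κ A t J ∩ closedRegion κ A t J' := by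
  obtain ⟨R, R', hR, hR', hne, hL, -⟩ := hL
  obtain ⟨J, hJ, rfl⟩ := (isRegion_iff hs).1 hR
  obtain ⟨J', hJ', rfl⟩ := (isRegion_iff hs).1 hR'
  refine ⟨J, J', fun h => hne (by rw [h]), ?_⟩
  rw [hL, closure_cell hJ, closure_cell hJ']

theorem separates_regions [Nonempty {J : Finset (Fin n) // 0 < minor A J}]
    (hs : Function.Injective (slopeX κ A))
    {J J' : {J : Finset (Fin n) // 0 < minor A J}} (hne : J ≠ J')
    (hJ : (region κ A t J).Nonempty) (hJ' : (region κ A t J').Nonempty)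
    (h : (closedRegion κ A t J ∩ closedRegion κ A t J').Nontrivial) :
    Separates κ A t (closedRegion κ A t J ∩ closedRegion κ A t J') (region κ A t J)
      (region κ A t J') := by
  refine ⟨(isRegion_iff hs).2 ⟨J, hJ, rfl⟩, (isRegion_iff hs).2 ⟨J', hJ', rfl⟩,
    fun e => hne (region_injective hJ e), ?_, h⟩
  rw [closure_cell hJ, closure_cell hJ']

/-! ### From an envelope to the asymptotic picture. -/

variable {ε : ℝ} {l : Filter ℝ} {N : ℕ} {u : Fin N → ℝ}
  {J : Fin (N + 1) → {J : Finset (Fin n) // 0 < minor A J}}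

theorem IsSlice.region_nonempty (hs : Function.Injective (slopeX κ A))
    (hJ : IsEnvelope (slopeX κ A) (slopeY κ A) ε u J) {y : ℝ} {x : Fin N → ℝ}
    (hx : IsSlice (slopeX κ A) (slopeY κ A) (offset κ A t) J y x) (m : Fin (N + 1)) :
    (region κ A t (J m)).Nonempty := by
  classical
  obtain ⟨r, h1, h2⟩ := Order.exists_between_finsets
    (lo := (Finset.univ.filter fun j : Fin N => j.castSucc < m).image x)
    (hi := (Finset.univ.filter fun j : Fin N => m ≤ j.castSucc).image x) (by
      intro a ha b hb
      simp only [Finset.mem_image, Finset.mem_filter, Finset.mem_univ, true_and] at ha hb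
      obtain ⟨i, hi, rfl⟩ := ha
      obtain ⟨j, hj, rfl⟩ := hb
      exact hx.strictMono (Fin.castSucc_lt_castSucc_iff.1 (hi.trans_le hj)))
  refine ⟨(r, y), hx.mem_cell hs hJ.slope_min hJ.slope_max m r (fun j hj => h1 _ ?_)
    fun j hj => h2 _ ?_⟩
  · exact Finset.mem_image_of_mem x (by simpa using hj)
  · exact Finset.mem_image_of_mem x (by simpa using hj)

theorem IsSlice.mem_inter_iff (hJ : IsEnvelope (slopeX κ A) (slopeY κ A) ε u J) {y : ℝ}
    {x : Fin N → ℝ} (hx : IsSlice (slopeX κ A) (slopeY κ A) (offset κ A t) J y x) (m : Fin N)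
    (r : ℝ) : (r, y) ∈ closedRegion κ A t (J m.castSucc) ∩ closedRegion κ A t (J m.succ) ↔
      r = x m := by
  constructor
  · rintro ⟨h1, h2⟩
    have h3 := le_antisymm (h1 (J m.succ)) (h2 (J m.castSucc))
    have h4 := hx.tie m
    have h5 := hJ.slope_lt m
    simp only [plane] at h3 h4
    have h6 : (slopeX κ A (J m.succ) - slopeX κ A (J m.castSucc)) * (r - x m) = 0 := by linarith
    rcases mul_eq_zero.1 h6 with h | h <;> linarith
  · rintro rfl
    exact ⟨hx.le_left m, hx.le_right m⟩

theorem asymptoticPicture_of_isEnvelope [Nonempty {J : Finset (Fin n) // 0 < minor A J}]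
    [l.NeBot] (hκ : StrictMono κ) (hA : ∀ J, 0 ≤ minor A J)
    (hs : Function.Injective (slopeX κ A)) (hε : ε * ε = 1)
    (hl : Tendsto (fun y => ε * y) l atTop) (hu : StrictMono u)
    (hJ : IsEnvelope (slopeX κ A) (slopeY κ A) ε u J) {a b : Fin N → Fin n}
    (hab : ∀ m, a m < b m) (hex : ∀ m, a m ∈ (J m.castSucc).1 ∧ b m ∉ (J m.castSucc).1 ∧
      (J m.succ).1 = insert (b m) ((J m.castSucc).1 \ {a m})) :
    AsymptoticPicture κ A t l a b (fun m => region κ A t (J m)) (fun m => (J m).1)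
      fun m => closedRegion κ A t (J m.castSucc) ∩ closedRegion κ A t (J m.succ) := by
  have hev := hJ.eventually_isSlice (c := offset κ A t) hu hε hl
  have hne : ∀ m, (region κ A t (J m)).Nonempty := by
    obtain ⟨y, x, hx⟩ := hev.exists
    exact hx.region_nonempty hs hJ
  have hJne : ∀ m : Fin N, J m.castSucc ≠ J m.succ := fun m e =>
    (hJ.slope_lt m).ne (by rw [e])
  have hsep : ∀ m : Fin N, Separates κ A t
      (closedRegion κ A t (J m.castSucc) ∩ closedRegion κ A t (J m.succ))
      (region κ A t (J m.castSucc)) (region κ A t (J m.succ)) := by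
    intro m
    refine separates_regions hs (hJne m) (hne _) (hne _) ?_
    obtain ⟨y, x, hx⟩ := hev.exists
    -- Two slices at different heights give two points of the soliton.
    obtain ⟨y', ⟨x', hx'⟩, hy'⟩ := (hev.and (hl.eventually_gt_atTop (ε * y))).exists
    refine ⟨(x m, y), (hx.mem_inter_iff hJ m _).2 rfl, (x' m, y'),
      (hx'.mem_inter_iff hJ m _).2 rfl, fun e => ?_⟩
    rw [(Prod.mk.inj e).2] at hy'
    exact lt_irrefl _ hy'
  refine ⟨fun m => (isRegion_iff hs).2 ⟨_, hne m, rfl⟩,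
    fun m I => isDominantOn_region_iff hκ hA (hne m) I, hsep, fun m => ?_, hex, fun S => ?_, ?_⟩
  · refine ⟨hab m, _, _, hsep m, (J m.castSucc).1 \ {a m}, by simp, ?_, ?_, ?_⟩
    · simp [(hex m).2.1]
    · rw [isDominantOn_region_iff hκ hA (hne _), ← Finset.erase_eq,
        Finset.insert_erase (hex m).1]
    · rw [isDominantOn_region_iff hκ hA (hne _), (hex m).2.2]
  · constructor
    · rintro ⟨hS, hext⟩
      obtain ⟨I, I', hI, rfl⟩ := exists_of_isLineSoliton hs hS
      -- One sufficiently distant point suffices: two closed cells meet there, so it is a cut point,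
      -- where only the two consecutive functions are maximal.
      obtain ⟨y, ⟨r, hr⟩, x, hx⟩ := (hext.and_eventually hev).exists
      rcases hx.cases hs hJ.slope_min hJ.slope_max r with ⟨m, rfl⟩ | ⟨m, hm⟩
      · refine ⟨m, ?_⟩
        rcases hx.eq_or_eq hr.1 with h | h <;> rcases hx.eq_or_eq hr.2 with h' | h'
        · exact absurd (h.trans h'.symm) hI
        · rw [h, h']
        · rw [h, h', Set.inter_comm]
        · exact absurd (h.trans h'.symm) hI
      · exact absurd hm (not_mem_cell_of_mem_inter hI hr.1 hr.2)
    · rintro ⟨m, rfl⟩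
      refine ⟨⟨_, _, hsep m⟩, Eventually.frequently ?_⟩
      filter_upwards [hev] with y ⟨x, hx⟩
      exact ⟨x m, (hx.mem_inter_iff hJ m _).2 rfl⟩
  · filter_upwards [hev] with y ⟨x, hx⟩
    refine ⟨x, hx.strictMono, ?_, hx.mem_inter_iff hJ,
      hx.mem_cell hs hJ.slope_min hJ.slope_max⟩
    ext r
    rw [Set.mem_ofPred_eq, contourPlot_eq, mem_kinks_iff hs]
    constructor
    · intro h
      rcases hx.cases hs hJ.slope_min hJ.slope_max r with ⟨m, rfl⟩ | ⟨m, hm⟩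
      · exact ⟨m, rfl⟩
      · exact absurd hm (h _)
    · rintro ⟨m, rfl⟩ i
      exact not_mem_cell_of_mem_inter (hJne m) (hx.le_left m) (hx.le_right m)

/-- A region that extends to infinity is one of those seen in the asymptotic picture. -/
theorem eq_region_of_extendsAlong (hs : Function.Injective (slopeX κ A)) (hε : ε * ε = 1)
    (hl : Tendsto (fun y => ε * y) l atTop) (hu : StrictMono u)
    (hJ : IsEnvelope (slopeX κ A) (slopeY κ A) ε u J)
    {I : {J : Finset (Fin n) // 0 < minor A J}} (hI : ExtendsAlong l (region κ A t I)) :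
    ∃ m, I = J m := by
  have hev := hJ.eventually_isSlice (c := offset κ A t) hu hε hl
  obtain ⟨y, ⟨r, hr⟩, x, hx⟩ := (hI.and_eventually hev).exists
  rcases hx.cases hs hJ.slope_min hJ.slope_max r with ⟨m, rfl⟩ | ⟨m, hm⟩
  · have hne : J m.castSucc ≠ J m.succ := fun e => (hJ.slope_lt m).ne (by rw [e])
    exact absurd hr (not_mem_cell_of_mem_inter hne (hx.le_left m) (hx.le_right m))
  · exact ⟨m, eq_of_mem_cell_of_mem_closedCell hm (cell_subset_closedCell I hr)⟩

end Contour

/-! ### Ties between maximal bases and the permutation. -/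

section Ties

variable {k n : ℕ} {κ : Fin n → ℝ} {A : Matrix (Fin k) (Fin n) ℝ} {ε u : ℝ}

/-- The weight of a single exponential in the direction `x = u * |y|`, `y = ε * |y|`. -/
noncomputable def weight (κ : Fin n → ℝ) (ε u : ℝ) (m : Fin n) : ℝ := κ m * u + ε * κ m ^ 2

theorem weight_sub (a m : Fin n) : weight κ ε u m - weight κ ε u a =
    (κ m - κ a) * (u + ε * (κ m + κ a)) := by
  simp only [weight]; ring

theorem weight_eq_iff (hκ : StrictMono κ) {a b : Fin n} (hab : a ≠ b) :
    weight κ ε u a = weight κ ε u b ↔ u = -ε * (κ a + κ b) := by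
  rw [eq_comm, ← sub_eq_zero, weight_sub, mul_eq_zero,
    or_iff_right (sub_ne_zero.2 fun h => hab (hκ.injective h).symm)]
  constructor <;> intro h <;> linarith

/-- A nondegenerate quadratic takes each value at most twice. -/
theorem weight_class (hκ : StrictMono κ) (hε : ε * ε = 1) (a b m : Fin n) (hab : a ≠ b)
    (h : weight κ ε u a = weight κ ε u b) (hm : weight κ ε u m = weight κ ε u a) :
    m = a ∨ m = b := by
  by_cases hma : m = a
  · exact Or.inl hma
  · right
    rw [weight_eq_iff hκ hab] at h
    rw [weight_eq_iff hκ hma, h] at hm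
    apply hκ.injective
    have : ε * (ε * (κ m - κ b)) = 0 := by linear_combination ε * hm
    rw [← mul_assoc, hε] at this
    linarith

theorem GenericParams.pair (hgen : GenericParams k κ) (hk : 2 ≤ k) {a b a' b' : Fin n}
    (hab : a ≠ b) (hab' : a' ≠ b') (h : κ a + κ b = κ a' + κ b') :
    a = a' ∧ b = b' ∨ a = b' ∧ b = a' := by
  have h1 := hgen 2 le_rfl hk {a, b} {a', b'} (Finset.card_pair hab) (Finset.card_pair hab')
    (by rw [Finset.sum_pair hab, Finset.sum_pair hab', h])
  have ha : a ∈ ({a', b'} : Finset (Fin n)) := h1 ▸ Finset.mem_insert_self a {b}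
  have hb : b ∈ ({a', b'} : Finset (Fin n)) := h1 ▸ Finset.mem_insert_of_mem (by simp)
  simp only [Finset.mem_insert, Finset.mem_singleton] at ha hb
  rcases ha with rfl | rfl <;> rcases hb with rfl | rfl
  · exact absurd rfl hab
  · exact Or.inl ⟨rfl, rfl⟩
  · exact Or.inr ⟨rfl, rfl⟩
  · exact absurd rfl hab

theorem weight_pair (hκ : StrictMono κ) (hgen : GenericParams k κ) (hε : ε * ε = 1)
    (hk : 2 ≤ Module.finrank ℝ (Fin k → ℝ)) (a b a' b' : Fin n) (hab : a ≠ b) (hab' : a' ≠ b')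
    (h : weight κ ε u a = weight κ ε u b) (h' : weight κ ε u a' = weight κ ε u b') :
    a = a' ∨ a = b' := by
  rw [Module.finrank_fin_fun] at hk
  rw [weight_eq_iff hκ hab] at h
  rw [weight_eq_iff hκ hab', h] at h'
  have e : ε * (ε * (κ a + κ b - (κ a' + κ b'))) = 0 := by linear_combination (-ε) * h'
  rw [← mul_assoc, hε] at e
  rcases hgen.pair hk hab hab' (by linarith) with h | h
  · exact Or.inl h.1
  · exact Or.inr h.1

theorem slopeX_injective (hκ : StrictMono κ) (hgen : GenericParams k κ) :
    Function.Injective (slopeX κ A) := by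
  have hcard : ∀ J : {J : Finset (Fin n) // 0 < minor A J}, J.1.card = k := by
    rintro ⟨J, hJ⟩
    have := ((minor_ne_zero_iff A J).1 hJ.ne').2
    rwa [Module.finrank_fin_fun] at this
  intro J J' h
  apply Subtype.ext
  -- Genericity says nothing for `k < 2`; there `J` has at most one element and injectivity of `κ`
  -- is enough.
  rcases lt_or_ge k 2 with hk | hk
  · have h1 := hcard J
    have h2 := hcard J'
    rcases Nat.lt_or_ge k 1 with hk' | hk'
    · rw [Finset.card_eq_zero.1 (h1.trans (by omega)), Finset.card_eq_zero.1 (h2.trans (by omega))]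
    · obtain ⟨a, ha⟩ := Finset.card_eq_one.1 (h1.trans (by omega))
      obtain ⟨b, hb⟩ := Finset.card_eq_one.1 (h2.trans (by omega))
      simp only [slopeX, ha, hb, Finset.sum_singleton] at h
      rw [ha, hb, hκ.injective h]
  · exact hgen k hk le_rfl _ _ (hcard J) (hcard J') h

theorem sum_weight (J : {J : Finset (Fin n) // 0 < minor A J}) :
    ∑ m ∈ J.1, weight κ ε u m = slopeX κ A J * u + ε * slopeY κ A J := by
  simp only [weight, slopeX, slopeY, Finset.sum_add_distrib, Finset.sum_mul, Finset.mul_sum]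

theorem isMaxBase_iff {w : Fin n → ℝ} {J : {J : Finset (Fin n) // 0 < minor A J}}
    (hA : ∀ J, 0 ≤ minor A J) : IsMaxBase A.col w J.1 ↔
      ∀ I : {J : Finset (Fin n) // 0 < minor A J}, ∑ m ∈ I.1, w m ≤ ∑ m ∈ J.1, w m := by
  constructor
  · intro h I
    exact h.2 _ ((minor_ne_zero_iff A _).1 I.2.ne')
  · intro h
    exact ⟨(minor_ne_zero_iff A _).1 J.2.ne', fun I hI =>
      h ⟨I, (hA I).lt_of_ne ((minor_ne_zero_iff A I).2 hI).symm⟩⟩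

variable {I : Fin n → Finset (Fin n)} {π : Equiv.Perm (Fin n)}

/-- At the tie of `i` and `j`, the weight of `m` exceeds theirs by `ε * (κ m - κ j) * (κ m - κ i)`.
Multiplication by the positive number `ε * (κ i - κ j)` gives the cubic of `mem_between_iff`. -/
theorem between_eq (hκ : StrictMono κ) (hε : ε * ε = 1) {i j : Fin n}
    (hij : 0 < ε * (κ i - κ j)) (hu : u = -ε * (κ j + κ i)) :
    between i j = {m | weight κ ε u j < weight κ ε u m} := by
  have hne : i ≠ j := by
    rintro rfl; simp at hij
  ext m
  rw [mem_between_iff hκ hne, Set.mem_ofPred_eq,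
    ← sub_pos (b := weight κ ε u j), weight_sub, hu]
  have e : (κ i - κ j) * ((κ m - κ j) * (κ m - κ i)) =
      (ε * (κ i - κ j)) * ((κ m - κ j) * (-ε * (κ j + κ i) + ε * (κ m + κ j))) := by
    linear_combination (-(κ i - κ j) * ((κ m - κ j) * (κ m - κ i))) * hε
  rw [e, mul_pos_iff_of_pos_left hij]

/-- Two bases of maximal weight differ by the exchange of some `j` and `π j`. -/
theorem exists_perm_of_tie (hκ : StrictMono κ) (hgen : GenericParams k κ) (hε : ε * ε = 1)
    (hI : IsNecklaceOf {J | IsBase A.col J} I) (hπ : IsPermOfNecklace I π)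
    {J J' : Finset (Fin n)} (hJ : IsMaxBase A.col (weight κ ε u) J)
    (hJ' : IsMaxBase A.col (weight κ ε u) J') (hne : J ≠ J') :
    ∃ a ∈ J, ∃ b, b ∉ J ∧ J' = insert b (J.erase a) ∧ ∃ j, 0 < ε * (κ (π j) - κ j) ∧
      u = -ε * (κ j + κ (π j)) ∧ (j = a ∧ π j = b ∨ j = b ∧ π j = a) := by
  obtain ⟨a, ha, b, hb, hw, e⟩ := hJ.eq_exchange hJ' hne (weight_pair hκ hgen hε)
  refine ⟨a, ha, b, hb, e, ?_⟩
  have hab : a ≠ b := fun h => hb (h ▸ ha)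
  have hu := (weight_eq_iff hκ hab).1 hw
  have hcls := weight_class (u := u) hκ hε a b
  have h1 := hJ.span_of_exchange ha hb hw (e ▸ hJ'.1) (fun m hm => hcls m hab hw hm)
  have e' : J = insert a (J'.erase b) := by
    rw [e, Finset.erase_insert (fun h => hb (Finset.mem_of_mem_erase h)), Finset.insert_erase ha]
  have ha' : a ∉ J' := by
    rw [e]; simp [hab]
  have hb' : b ∈ J' := by
    rw [e]; simp
  have h2 := hJ'.span_of_exchange hb' ha' hw.symm (e' ▸ hJ.1)
    (fun m hm => (hcls m hab hw (hm.trans hw.symm)).symm)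
  have hεne : ε ≠ 0 := fun h => by simp [h] at hε
  rcases lt_or_gt_of_ne (mul_ne_zero hεne (sub_ne_zero.2 fun h => hab (hκ.injective h))) with h | h
  · have hpos : 0 < ε * (κ b - κ a) := by linarith
    rw [← between_eq hκ hε hpos hu] at h1
    have := perm_eq_of_span hI hπ hab.symm h1.1 h1.2
    exact ⟨a, by rw [this]; exact hpos, by rw [this]; exact hu, Or.inl ⟨rfl, this⟩⟩
  · have hu' : u = -ε * (κ b + κ a) := by rw [hu]; ring
    rw [← between_eq hκ hε h hu'] at h2
    have := perm_eq_of_span hI hπ hab h2.1 h2.2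
    exact ⟨b, by rw [this]; exact h, by rw [this]; exact hu', Or.inr ⟨rfl, this⟩⟩

/-- For `u = -ε * (κ j + κ (π j))` a basis of maximal weight contains exactly one of `j` and
`π j`, and exchanging them yields another basis of maximal weight. -/
theorem exists_tie_of_perm (hκ : StrictMono κ) (hε : ε * ε = 1)
    (hI : IsNecklaceOf {J | IsBase A.col J} I) (hπ : IsPermOfNecklace I π) {j : Fin n}
    (hj : 0 < ε * (κ (π j) - κ j)) (hu : u = -ε * (κ j + κ (π j))) {J : Finset (Fin n)}
    (hJ : IsMaxBase A.col (weight κ ε u) J) :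
    ∃ x ∈ J, ∃ y, y ∉ J ∧ (x = π j ∧ y = j ∨ x = j ∧ y = π j) ∧
      IsMaxBase A.col (weight κ ε u) (insert y (J.erase x)) := by
  obtain ⟨h0, h1, h2⟩ := perm_spec hI hπ j
  rw [between_eq hκ hε hj hu] at h1 h2
  have hw := (weight_eq_iff hκ h0.symm).2 hu
  exact hJ.exists_tie h0 hw (fun m hm => (weight_class hκ hε _ _ m h0.symm hw hm).symm) h1 h2

/-- Equal thresholds give two swaps of one maximal basis, and at most two bases are maximal, so the
swaps agree. The pairs `{j, π j}` and `{j', π j'}` then coincide, and the common sign condition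
rules out the reversed matching. This argument also covers rank one, where genericity is void. -/
theorem threshold_injOn (hκ : StrictMono κ) (hgen : GenericParams k κ) (hε : ε * ε = 1)
    (hI : IsNecklaceOf {J | IsBase A.col J} I) (hπ : IsPermOfNecklace I π)
    (hmax : ∀ w, ∃ J, IsMaxBase A.col w J) :
    Set.InjOn (fun j => -ε * (κ j + κ (π j))) {j | 0 < ε * (κ (π j) - κ j)} := by
  intro j hj j' hj' h
  simp only [Set.mem_ofPred_eq] at hj hj' h
  obtain ⟨J, hJ⟩ := hmax (weight κ ε (-ε * (κ j + κ (π j))))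
  obtain ⟨x, hx, y, hy, hxy, hJ₁⟩ := exists_tie_of_perm hκ hε hI hπ hj rfl hJ
  obtain ⟨x', hx', y', hy', hxy', hJ₂⟩ := exists_tie_of_perm hκ hε hI hπ hj' h hJ
  have hmem : ∀ {x y}, x ∈ J → y ∉ J → J ≠ insert y (J.erase x) := fun _ hy e =>
    hy (e ▸ Finset.mem_insert_self _ _)
  have heq : insert y' (J.erase x') = insert y (J.erase x) :=
    (hJ.eq_or_eq hJ₁ hJ₂ (hmem hx hy) (weight_pair hκ hgen hε)
      (weight_class hκ hε)).resolve_left (hmem hx' hy').symm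
  have hyy : y = y' := by
    have : y ∈ insert y' (J.erase x') := heq ▸ Finset.mem_insert_self _ _
    rcases Finset.mem_insert.1 this with h | h
    · exact h
    · exact absurd (Finset.mem_of_mem_erase h) hy
  have hxx : x = x' := by
    by_contra hne
    have : x ∈ insert y (J.erase x) := heq ▸ Finset.mem_insert_of_mem
      (Finset.mem_erase.2 ⟨hne, hx⟩)
    rcases Finset.mem_insert.1 this with h | h
    · exact hy (h ▸ hx)
    · exact Finset.notMem_erase _ _ h
  rcases hxy with ⟨h1, h2⟩ | ⟨h1, h2⟩ <;> rcases hxy' with ⟨h3, h4⟩ | ⟨h3, h4⟩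
  · rw [← h2, hyy, h4]
  · exfalso
    have e1 : π j = j' := by rw [← h1, hxx, h3]
    have e2 : π j' = j := by rw [← h4, ← hyy, h2]
    rw [e1] at hj; rw [e2] at hj'; linarith
  · exfalso
    have e1 : π j' = j := by rw [← h3, ← hxx, h1]
    have e2 : π j = j' := by rw [← h2, hyy, h4]
    rw [e2] at hj; rw [e1] at hj'; linarith
  · rw [← h1, hxx, h3]

/-- The basis of least slope consists of the excedance positions. -/
theorem mem_iff_excedance (hκ : StrictMono κ) (hI : IsNecklaceOf {J | IsBase A.col J} I)
    (hπ : IsPermOfNecklace I π) {J : Finset (Fin n)}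
    (hJ : IsMaxBase A.col (fun m => -κ m) J) (j : Fin n) : j ∈ J ↔ j < π j := by
  obtain ⟨h0, h1, h2⟩ := perm_spec hI hπ j
  constructor
  · intro hj
    by_contra! hle
    have hlt : κ (π j) < κ j := hκ (lt_of_le_of_ne hle h0)
    refine hJ.1.notMem_spanOf_erase hj ?_
    rw [spanOf, Set.image_insert_eq] at h2
    -- Steinitz exchange turns the statement about `v (π j)` into one about `v j`; for `π j < j` all
    -- indices involved are smaller than `j`, so `j` would not be chosen greedily.
    have h3 := mem_span_insert_exchange h2 h1
    rw [← Set.image_insert_eq] at h3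
    refine spanOf_mono ?_ (hJ.spanOf_gt_le (-κ j) (spanOf_mono (T := {m | -κ j < -κ m}) ?_ h3))
    · rintro m ⟨hm, hlt⟩
      simp only [Finset.coe_erase, Set.mem_sdiff, Finset.mem_coe, Set.mem_singleton_iff]
      exact ⟨hm, fun e => hlt.ne (by rw [e])⟩
    · rintro m (rfl | hm)
      · exact neg_lt_neg hlt
      · rw [mem_between_iff hκ h0] at hm
        simp only [Set.mem_ofPred_eq, neg_lt_neg_iff]
        by_contra! hcon
        have : 0 ≤ (κ m - κ j) * (κ m - κ (π j)) :=
          mul_nonneg (by linarith) (by linarith)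
        nlinarith
  · intro hlt
    by_contra hj
    have hlt' : κ j < κ (π j) := hκ hlt
    refine h1 ((spanOf_le ?_ : spanOf A.col (insert j (between (π j) j)) ≤ _) h2)
    rintro m (rfl | hm)
    -- If `j` is not in `J`, its vector is spanned by members of `J` with smaller index, and for `j
    -- < π j` these all lie in the wrapped interval from `π j` to `j`.
    · refine spanOf_mono ?_ (hJ.mem_spanOf_ge m)
      rintro m' ⟨hm', hle⟩
      have hlt2 : κ m' < κ m := lt_of_le_of_ne (neg_le_neg_iff.1 hle)
        fun e => hj (hκ.injective e ▸ hm')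
      rw [mem_between_iff hκ h0]
      exact mul_pos (by linarith) (mul_pos_of_neg_of_neg (by linarith) (by linarith))
    · exact mem_spanOf hm

end Ties

/-! ### The chain of exchanges in one vertical direction. -/

section Direction

variable {k n : ℕ} {κ : Fin n → ℝ} {A : Matrix (Fin k) (Fin n) ℝ} {ε : ℝ}
  {I : Fin n → Finset (Fin n)} {π : Equiv.Perm (Fin n)}

theorem exists_isMaxBase [Nonempty {J : Finset (Fin n) // 0 < minor A J}]
    (hA : ∀ J, 0 ≤ minor A J) (w : Fin n → ℝ) : ∃ J, IsMaxBase A.col w J := by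
  obtain ⟨J, hJ⟩ := Finite.exists_max fun J : {J : Finset (Fin n) // 0 < minor A J} =>
    ∑ m ∈ J.1, w m
  exact ⟨J.1, (isMaxBase_iff hA).2 hJ⟩

/-- The upper envelope in the direction `ε`, with the exchanges at its break points. -/
theorem exists_chain [Nonempty {J : Finset (Fin n) // 0 < minor A J}] (hκ : StrictMono κ)
    (hgen : GenericParams k κ) (hA : ∀ J, 0 ≤ minor A J) (hε : ε * ε = 1)
    (hI : IsNecklaceOf {J | IsBase A.col J} I) (hπ : IsPermOfNecklace I π)
    {E : Finset (Fin n)} (hE : ∀ j, j ∈ E ↔ 0 < ε * (κ (π j) - κ j)) {N : ℕ} (hN : E.card = N) :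
    ∃ (e : Fin N → Fin n) (J : Fin (N + 1) → {J : Finset (Fin n) // 0 < minor A J}),
      Set.range e = E ∧ StrictMono (fun m => -ε * (κ (e m) + κ (π (e m)))) ∧
      IsEnvelope (slopeX κ A) (slopeY κ A) ε (fun m => -ε * (κ (e m) + κ (π (e m)))) J ∧
      ∀ m, ∃ a b, a < b ∧ a ∈ (J m.castSucc).1 ∧ b ∉ (J m.castSucc).1 ∧
        (J m.succ).1 = insert b ((J m.castSucc).1 \ {a}) ∧
        (e m = a ∧ π (e m) = b ∨ e m = b ∧ π (e m) = a) := by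
  subst hN
  have hs := slopeX_injective (A := A) hκ hgen
  have hinj := threshold_injOn hκ hgen hε hI hπ (exists_isMaxBase hA)
  have hinj' : Set.InjOn (fun j => -ε * (κ j + κ (π j))) (E : Set (Fin n)) :=
    hinj.mono fun j hj => (hE j).1 hj
  obtain ⟨e, he, hmono⟩ := exists_strictMono_enum E hinj'
  have heE : ∀ m, 0 < ε * (κ (π (e m)) - κ (e m)) := fun m =>
    (hE _).1 (Finset.mem_coe.1 (he ▸ Set.mem_range_self m))
  have hmaxiff : ∀ (v : ℝ) (J : {J : Finset (Fin n) // 0 < minor A J}),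
      (∀ h, slopeX κ A h * v + ε * slopeY κ A h ≤ slopeX κ A J * v + ε * slopeY κ A J) ↔
        IsMaxBase A.col (weight κ ε v) J.1 := by
    intro v J
    rw [isMaxBase_iff hA]
    simp only [sum_weight]
  obtain ⟨J, hJ⟩ := exists_isEnvelope (s := slopeX κ A) (q := slopeY κ A) (ε := ε) hs hmono
    (by
      intro v
      simp only [hmaxiff]
      constructor
      · rintro ⟨m, rfl⟩
        obtain ⟨J, hJ⟩ := exists_isMaxBase hA (weight κ ε (-ε * (κ (e m) + κ (π (e m)))))
        obtain ⟨x, hx, y, hy, -, hJ'⟩ := exists_tie_of_perm hκ hε hI hπ (heE m) rfl hJ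
        have hpos : ∀ {J}, IsBase A.col J → 0 < minor A J := fun h =>
          (hA _).lt_of_ne ((minor_ne_zero_iff A _).2 h).symm
        refine ⟨⟨_, hpos hJ.1⟩, ⟨_, hpos hJ'.1⟩, fun h => hy ?_, hJ, hJ'⟩
        exact (Subtype.mk.inj h).symm ▸ Finset.mem_insert_self _ _
      · rintro ⟨J, J', hne, hJ, hJ'⟩
        obtain ⟨a, -, b, -, -, j, hj, hv, -⟩ := exists_perm_of_tie hκ hgen hε hI hπ hJ hJ'
          (fun h => hne (Subtype.ext h))
        have : j ∈ Set.range e := he ▸ Finset.mem_coe.2 ((hE j).2 hj)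
        obtain ⟨m, rfl⟩ := this
        exact ⟨m, hv⟩)
    (by
      intro v J J' J'' hne
      simp only [hmaxiff]
      intro hJ hJ' hJ''
      rcases hJ.eq_or_eq hJ' hJ'' (fun h => hne (Subtype.ext h)) (weight_pair hκ hgen hε)
        (weight_class hκ hε) with h | h
      · exact Or.inl (Subtype.ext h)
      · exact Or.inr (Subtype.ext h))
  refine ⟨e, J, he, hmono, hJ, fun m => ?_⟩
  have hmax : ∀ h, slopeX κ A h * (-ε * (κ (e m) + κ (π (e m)))) + ε * slopeY κ A h ≤
      slopeX κ A (J m.castSucc) * (-ε * (κ (e m) + κ (π (e m)))) +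
        ε * slopeY κ A (J m.castSucc) := by
    intro h
    by_cases h1 : h = J m.castSucc
    · rw [h1]
    by_cases h2 : h = J m.succ
    · rw [h2]; exact (hJ.tie m).ge
    exact (hJ.lt m h h1 h2).le
  have hmax' := fun h => (hmax h).trans (hJ.tie m).le
  have hslope := hJ.slope_lt m
  obtain ⟨a, ha, b, hb, hex, j, hj, hv, hjab⟩ := exists_perm_of_tie hκ hgen hε hI hπ
    ((hmaxiff _ _).1 hmax) ((hmaxiff _ _).1 hmax')
    (fun h => hslope.ne (by rw [Subtype.ext h]))
  -- The tie comes from some index with this threshold, and thresholds determine the index.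
  obtain rfl : e m = j := hinj (heE m) hj hv
  refine ⟨a, b, ?_, ha, hb, by rw [← Finset.erase_eq]; exact hex, hjab⟩
  -- Slopes increase along the envelope, so the entering index is the larger one.
  have : slopeX κ A (J m.succ) = slopeX κ A (J m.castSucc) - κ a + κ b := by
    rw [slopeX, hex, sum_exchange κ ha hb]; rfl
  exact hκ.lt_iff_lt.1 (by linarith)

end Direction

end KPSoliton

/- The irreducibility hypothesis follows from `hπ`: `IsPermOfNecklace` with `π` bijective puts every
column into some basis (see `perm_spec`), and `j ≠ i` there excludes coloops. -/
open KPSoliton in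
theorem mainTheorem7 {k n : ℕ} (κ : Fin n → ℝ) (hκ : StrictMono κ)
    (hgen : KPSoliton.GenericParams k κ)
    (M : Set (Finset (Fin n))) (hirr : KPSoliton.IsIrreducibleCell k M)
    (π : Equiv.Perm (Fin n)) (hπ : KPSoliton.IsCellPerm M π)
    (A : Matrix (Fin k) (Fin n) ℝ) (hA : A ∈ KPSoliton.positroidCell k M) (t₀ : ℝ) :
    (KPSoliton.excedancePositions π).card = k ∧
    (KPSoliton.nonexcedancePositions π).card = n - k ∧
    ∃ (e : Fin k → Fin n) (g : Fin (n - k) → Fin n)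
      (R : Fin (k + 1) → Set (ℝ × ℝ)) (J : Fin (k + 1) → Finset (Fin n))
      (L : Fin k → Set (ℝ × ℝ))
      (R' : Fin (n - k + 1) → Set (ℝ × ℝ)) (J' : Fin (n - k + 1) → Finset (Fin n))
      (L' : Fin (n - k) → Set (ℝ × ℝ)),
      -- the excedances, in decreasing order of `κ i + κ (π i)`
      Set.range e = KPSoliton.excedancePositions π ∧
      StrictAnti (fun m => κ (e m) + κ (π (e m))) ∧
      -- the nonexcedances, in increasing order of `κ j + κ (π j)`
      Set.range g = KPSoliton.nonexcedancePositions π ∧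
      StrictMono (fun m => κ (g m) + κ (π (g m))) ∧
      -- the contour plot for `y ≫ 0` and for `y ≪ 0`
      KPSoliton.AsymptoticPicture κ A t₀ Filter.atTop e (fun m => π (e m)) R J L ∧
      KPSoliton.AsymptoticPicture κ A t₀ Filter.atBot (fun m => π (g m)) g R' J' L' ∧
      -- the unbounded region for `x ≪ 0`, and the one for `x ≫ 0`
      R 0 = R' 0 ∧ J 0 = KPSoliton.excedancePositions π ∧
      R (Fin.last k) = R' (Fin.last (n - k)) ∧
      (∃ C : ℝ, ∀ x y : ℝ, x < -C * (1 + |y|) → (x, y) ∈ R 0) ∧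
      (∃ C : ℝ, ∀ x y : ℝ, C * (1 + |y|) < x → (x, y) ∈ R (Fin.last k)) ∧
      -- there are no other unbounded line-solitons and no other unbounded regions
      (∀ S, KPSoliton.IsLineSoliton κ A t₀ S → ¬ Bornology.IsBounded S →
        (∃ m, S = L m) ∨ (∃ m, S = L' m)) ∧
      (∀ S, KPSoliton.IsRegion κ A t₀ S → ¬ Bornology.IsBounded S →
        (∃ m, S = R m) ∨ (∃ m, S = R' m)) := by
  obtain ⟨I, hI, hπ⟩ := hπ
  have : Nonempty {J : Finset (Fin n) // 0 < minor A J} := nonempty_pos_minor hA hI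
  have hnn := minor_nonneg hA
  rw [eq_setOf_isBase hA] at hI
  have hs := slopeX_injective (A := A) hκ hgen
  have hE : ∀ j, j ∈ excedancePositions π ↔ 0 < (1 : ℝ) * (κ (π j) - κ j) := fun j => by
    simp [excedancePositions, hκ.lt_iff_lt]
  have hE' : ∀ j, j ∈ nonexcedancePositions π ↔ 0 < (-1 : ℝ) * (κ (π j) - κ j) := fun j => by
    simp [nonexcedancePositions, hκ.lt_iff_lt]
  have hmin : ∀ J : {J : Finset (Fin n) // 0 < minor A J},
      (∀ I, slopeX κ A J ≤ slopeX κ A I) → J.1 = excedancePositions π := by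
    intro J hJ
    have hJ' : IsMaxBase A.col (fun m => -κ m) J.1 := (isMaxBase_iff hnn).2 fun I => by
      simpa [slopeX] using hJ I
    ext j
    rw [mem_iff_excedance hκ hI hπ hJ' j]
    simp [excedancePositions]
  have hcard : (excedancePositions π).card = k := by
    obtain ⟨J, hJ⟩ := Finite.exists_min (slopeX κ A)
    rw [← hmin J hJ, ((minor_pos_iff hA J.1).1 J.2).2, Module.finrank_fin_fun]
  have hcard' : (nonexcedancePositions π).card = n - k := by
    have h : nonexcedancePositions π = (excedancePositions π)ᶜ := by
      ext j
      have := (perm_spec hI hπ j).1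
      simp only [nonexcedancePositions, excedancePositions, Finset.mem_filter, Finset.mem_univ,
        true_and, Finset.mem_compl, not_lt]
      exact ⟨le_of_lt, fun h => lt_of_le_of_ne h this⟩
    rw [h, Finset.card_compl, hcard, Fintype.card_fin]
  have hl : Tendsto (fun y : ℝ => (1 : ℝ) * y) atTop atTop := by
    simp only [one_mul]
    exact tendsto_id
  have hl' : Tendsto (fun y : ℝ => (-1 : ℝ) * y) atBot atTop := by
    simpa using tendsto_neg_atBot_atTop
  obtain ⟨e, J, he, hemono, hJ, hex⟩ :=
    exists_chain hκ hgen hnn (by norm_num) hI hπ hE hcard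
  obtain ⟨g, J', hg, hgmono, hJ', hex'⟩ :=
    exists_chain hκ hgen hnn (by norm_num) hI hπ hE' hcard'
  have hexc : ∀ m, e m < π (e m) ∧ e m ∈ (J m.castSucc).1 ∧ π (e m) ∉ (J m.castSucc).1 ∧
      (J m.succ).1 = insert (π (e m)) ((J m.castSucc).1 \ {e m}) := by
    intro m
    have hlt : e m < π (e m) := by
      have : e m ∈ (excedancePositions π : Set (Fin n)) := he ▸ Set.mem_range_self m
      simpa [excedancePositions] using this
    obtain ⟨a, b, hab, h1, h2, h3, ⟨rfl, rfl⟩ | ⟨rfl, h⟩⟩ := hex m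
    · exact ⟨hlt, h1, h2, h3⟩
    · exact absurd (h ▸ hlt) hab.not_gt
  have hexc' : ∀ m, π (g m) < g m ∧ π (g m) ∈ (J' m.castSucc).1 ∧ g m ∉ (J' m.castSucc).1 ∧
      (J' m.succ).1 = insert (g m) ((J' m.castSucc).1 \ {π (g m)}) := by
    intro m
    have hlt : π (g m) < g m := by
      have : g m ∈ (nonexcedancePositions π : Set (Fin n)) := hg ▸ Set.mem_range_self m
      simpa [nonexcedancePositions] using this
    obtain ⟨a, b, hab, h1, h2, h3, ⟨rfl, h⟩ | ⟨rfl, rfl⟩⟩ := hex' m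
    · exact absurd (h ▸ hlt) hab.not_gt
    · exact ⟨hlt, h1, h2, h3⟩
  have pic := asymptoticPicture_of_isEnvelope (t := t₀) hκ hnn hs (by norm_num) hl hemono hJ
    (fun m => (hexc m).1) fun m => (hexc m).2
  have pic' := asymptoticPicture_of_isEnvelope (t := t₀) hκ hnn hs (by norm_num) hl' hgmono hJ'
    (fun m => (hexc' m).1) fun m => (hexc' m).2
  -- Both envelopes begin at the unique basis of least slope, and both end at that of greatest
  -- slope.
  have hfirst : J 0 = J' 0 := hs (le_antisymm (hJ.slope_min _) (hJ'.slope_min _))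
  have hlast : J (Fin.last k) = J' (Fin.last (n - k)) :=
    hs (le_antisymm (hJ'.slope_max _) (hJ.slope_max _))
  obtain ⟨C, hC⟩ := exists_cone_subset_cell (s := slopeX κ A) (q := slopeY κ A)
    (c := offset κ A t₀) (i := J 0) (σ := 1) (by norm_num) fun j hj => by
      have := lt_of_le_of_ne (hJ.slope_min j) fun h => hj (hs h).symm
      linarith
  obtain ⟨D, hD⟩ := exists_cone_subset_cell (s := slopeX κ A) (q := slopeY κ A)
    (c := offset κ A t₀) (i := J (Fin.last k)) (σ := -1) (by norm_num) fun j hj => by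
      have := lt_of_le_of_ne (hJ.slope_max j) fun h => hj (hs h)
      linarith
  refine ⟨hcard, hcard', e, g, _, _, _, _, _, _, he, fun m m' h => ?_, hg, fun m m' h => ?_,
    pic, pic', by rw [hfirst], hmin _ hJ.slope_min, by rw [hlast], ⟨C, fun x y h => ?_⟩,
    ⟨D, fun x y h => ?_⟩, fun S hS hb => ?_, fun S hS hb => ?_⟩
  · have := hemono h
    simp only at this ⊢
    linarith
  · have := hgmono h
    simp only at this ⊢
    linarith
  · exact hC x y (by linarith)
  · exact hD x y (by linarith)
  · by_cases h1 : ExtendsAlong atTop S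
    · exact Or.inl ((pic.exhaustive S).1 ⟨hS, h1⟩)
    by_cases h2 : ExtendsAlong atBot S
    · exact Or.inr ((pic'.exhaustive S).1 ⟨hS, h2⟩)
    obtain ⟨B, hB⟩ := exists_abs_snd_le h1 h2
    obtain ⟨j, j', hne, rfl⟩ := exists_of_isLineSoliton hs hS
    obtain ⟨X, hX⟩ := exists_abs_fst_le (s := slopeX κ A) (q := slopeY κ A)
      (c := offset κ A t₀) (B := B) (hs.ne hne)
    exact absurd (isBounded_of_abs_le (fun p hp => hX p hp (hB p hp)) hB) hb
  · obtain ⟨j, hj, rfl⟩ := (isRegion_iff hs).1 hS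
    by_cases h1 : ExtendsAlong atTop (region κ A t₀ j)
    · obtain ⟨m, rfl⟩ := eq_region_of_extendsAlong hs (by norm_num) hl hemono hJ h1
      exact Or.inl ⟨m, rfl⟩
    by_cases h2 : ExtendsAlong atBot (region κ A t₀ j)
    · obtain ⟨m, rfl⟩ := eq_region_of_extendsAlong hs (by norm_num) hl' hgmono hJ' h2
      exact Or.inr ⟨m, rfl⟩
    obtain ⟨B, hB⟩ := exists_abs_snd_le h1 h2
    -- For heights at most `B`, this width is large enough that any point beyond it lies in one of
    -- the two cones, which identifies the region.
    by_cases hX : ∀ p ∈ region κ A t₀ j, |p.1| ≤ (|C| + |D|) * (1 + B)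
    · exact absurd (isBounded_of_abs_le hX hB) hb
    push Not at hX
    obtain ⟨⟨x, y⟩, hp, hx⟩ := hX
    have hy : |y| ≤ B := hB _ hp
    have hy0 := abs_nonneg y
    have hC' : C * (1 + |y|) ≤ (|C| + |D|) * (1 + B) :=
      mul_le_mul (by linarith [le_abs_self C, abs_nonneg D]) (by linarith) (by linarith)
        (by positivity)
    have hD' : D * (1 + |y|) ≤ (|C| + |D|) * (1 + B) :=
      mul_le_mul (by linarith [le_abs_self D, abs_nonneg C]) (by linarith) (by linarith)
        (by positivity)
    left
    rcases lt_abs.1 hx with h | h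
    · refine ⟨Fin.last k, ?_⟩
      rw [eq_of_mem_cell_of_mem_closedCell (hD x y (by simp only at h; linarith))
        (cell_subset_closedCell j hp)]
    · refine ⟨0, ?_⟩
      rw [eq_of_mem_cell_of_mem_closedCell (hC x y (by simp only at h; linarith))
        (cell_subset_closedCell j hp)]
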